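/- Let $\mathcal{SD}$ be the Lie superalgebra of regular differential operators on the supercircle $S^{1|1}$, i.e. the $2\times2$ supermatrices $\sum_k t^kF_k(D)$ with polynomial entries in $D=t\partial_t$ (product $t^rF(D)\cdot t^sG(D)=t^{r+s}F(D+s)G(D)$, super-bracket), with matrix units $M_0=\partial_\theta\theta$, $M_1=\theta\partial_\theta$, $M_+=\partial_\theta$, $M_-=\theta$. Let $\widehat{\mathcal{SD}}=\mathcal{SD}\oplus\mathbb C C$ be the central extension by the super skew-symmetric cocycle $\Psi(t^rF(D),t^sG(D))=\delta_{r+s,0}\sum_{-r\le j\le-1}\mathrm{Str}(F(j)G(j+r))$ for $r\ge0$. Write $[w]_n=w(w-1)\cdots(w-n+1)$. Let $\mathcal F^{\otimes l}$ be the Fock space of $l$ independent copies of fermionic fields $\psi^{+,p}(z)=\sum_{n\in\mathbb Z}\psi^{+,p}_nz^{-n-1}$, $\psi^{-,p}(z)=\sum_{n\in\mathbb Z}\psi^{-,p}_nz^{-n}$, $[\psi^{+,p}_m,\psi^{-,q}_n]_+=\delta_{pq}\delta_{m+n,0}$, and bosonic fields $\gamma^{\pm,p}(z)=\sum_{r\in\frac12+\mathbb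 Z}\gamma^{\pm,p}_rz^{-r-\frac12}$, $[\gamma^{+,p}_r,\gamma^{-,q}_s]=\delta_{pq}\delta_{r+s,0}$ (all other super-brackets zero), with a vacuum killed by $\psi^{+,p}_m,\psi^{-,p}_{m+1}$ $(m\ge0)$ and $\gamma^{\pm,p}_r$ $(r>0)$; normal ordering $:\ :$ moves these annihilation modes to the right. Let the elementary matrices $E_{ab}$ $(a,b\in\frac12\mathbb Z)$ act on $\mathcal F^{\otimes l}$ by $E_{ij}=\sum_p:\psi^{+,p}_{-i}\psi^{-,p}_j:$, $E_{rs}=-\sum_p:\gamma^{+,p}_{-r}\gamma^{-,p}_s:$, $E_{is}=\sum_p:\psi^{+,p}_{-i}\gamma^{-,p}_s:$, $E_{rj}=-\sum_p:\gamma^{+,p}_{-r}\psi^{-,p}_j:$ $(i,j\in\mathbb Z,\ r,s\in\frac12+\mathbb Z)$, and let $\widehat{\mathcal{SD}}$ act by $C\mapsto l$ and $t^kf(D)M_a\mapsto\sum_{j\in\mathbb Z}f(-j)E_{j-k,j}M_a$, where $E_{ij}M_0=E_{ij}$, $E_{ij}M_1=E_{i-\frac12,j-\frac12}$, $E_{ij}M_+=E_{i,j-\frac12}$,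 $E_{ij}M_-=E_{i-\frac12,j}$. Then all these infinite sums, and the sums of modes in the normally ordered products below, are locally finite; this is a representation of $\widehat{\mathcal{SD}}$ on the superspace $\mathcal F^{\otimes l}$ of central charge $l$; and for all $n\ge0$ (with $\partial=\partial_z$, sums over $1\le p\le l$): 1. The elements $J^{a,n}_k=-t^k[D]_nM_a$ $(a=0,1,\pm,\ k\in\mathbb Z,\ n\ge 0)$ and $C$ span $\widehat{\mathcal{SD}}$, and $J^{a,n}(z)=\sum_kJ^{a,n}_kz^{-n-k-1}$ acts by $J^{0,n}(z)=-\sum_p:\psi^{+,p}(z)\partial^n\psi^{-,p}(z):$, $J^{1,n}(z)=\sum_p:\gamma^{+,p}(z)\partial^n\gamma^{-,p}(z):$, $J^{+,n}(z)=-\sum_p:\psi^{+,p}(z)\partial^n\gamma^{-,p}(z):$, $J^{-,n}(z)=\sum_p:\gamma^{+,p}(z)\partial^n\psi^{-,p}(z):$. 2. Let ${}^0\widehat{\mathcal{SD}}$ be the subalgebra $\{e\in\mathcal{SD}:\sigma(e)=-e\}\oplus\mathbb CC$ for the anti-involution $\sigma$ with $t\mapsto-t$, $D\mapsto-D-1+\partial_\theta\theta$,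 $\theta\mapsto t\partial_\theta$, $\partial_\theta\mapsto-t^{-1}\theta$. It is spanned by $C$ and ${}^0W^n_{0,k}=t^k([D]_n+(-1)^{k+1}[-D-k]_n)\partial_\theta\theta$, ${}^0W^n_{1,k}=t^k([D]_n+(-1)^{k+1}[-D-k-1]_n)\theta\partial_\theta$, ${}^0W^n_{\times,k}=\theta t^k[D]_n+(-1)^{k+1}\partial_\theta t^{k+1}[-D-k-1]_n$ $(k\in\mathbb Z,\ n\ge0)$, and the generating functions ${}^0W^n_a(z)=\sum_k{}^0W^n_{a,k}z^{-k-n-1}$ act by ${}^0W^n_0(z)=\sum_p(:\psi^{+,p}(z)\partial^n\psi^{-,p}(z):+z^{-1}:\partial^n(z\psi^{+,p}(-z))\,\psi^{-,p}(-z):)$, ${}^0W^n_1(z)=-\sum_p(:\partial^n\gamma^{-,p}(z)\,\gamma^{+,p}(z):+:\partial^n(\gamma^{+,p}(-z))\,\gamma^{-,p}(-z):)$, ${}^0W^n_\times(z)=-\sum_p(:\partial^n\psi^{-,p}(z)\,\gamma^{+,p}(z):+:\partial^n(z\psi^{+,p}(-z))\,\gamma^{-,p}(-z):)$. 3. For signs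 $\varepsilon,\eta\in\{1,-1\}$ let ${}^{\varepsilon\eta}\widehat{\mathcal{SD}}$ be the subalgebra $\{e\in\mathcal{SD}:\sigma(e)=-e\}\oplus\mathbb CC$ for the anti-involution with $t\mapsto\varepsilon t$, $D\mapsto-D-1$, $\theta\mapsto\eta\theta$, $\partial_\theta\mapsto-\eta\partial_\theta$. It is spanned by $C$ and $W^n_k=t^k([D]_n\partial_\theta\theta-\varepsilon^k[-D-k-1]_n\theta\partial_\theta)$, $W^n_{+,k}=t^k([D]_n-\eta\varepsilon^k[-D-k-1]_n)\theta$, $W^n_{-,k}=t^k([D]_n+\eta\varepsilon^k[-D-k-1]_n)\partial_\theta$ $(k\in\mathbb Z,\ n\ge0)$. The generating functions $\sum_k(\cdot)_kz^{-k-n-1}$ act, for $\varepsilon=1$, by $W^n(z)=\sum_p(:\psi^{+,p}(z)\partial^n\psi^{-,p}(z):+:\partial^n\gamma^{+,p}(z)\,\gamma^{-,p}(z):)$, $W^n_+(z)=-\sum_p(:\gamma^{+,p}(z)\partial^n\psi^{-,p}(z):-\eta:\partial^n\gamma^{+,p}(z)\,\psi^{-,p}(z):)$, $W^n_-(z)=\sum_p(:\psi^{+,p}(z)\partial^n\gamma^{-,p}(z):+\eta:\partial^n\psi^{+,p}(z)\,\gamma^{-,p}(z):)$,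 and, for $\varepsilon=-1$, by $W^n(z)=\sum_p(:\psi^{+,p}(z)\partial^n\psi^{-,p}(z):-:\partial^n(\gamma^{+,p}(-z))\,\gamma^{-,p}(-z):)$, $W^n_+(z)=-\sum_p(:\gamma^{+,p}(z)\partial^n\psi^{-,p}(z):+\eta:\partial^n(\gamma^{+,p}(-z))\,\psi^{-,p}(-z):)$, $W^n_-(z)=\sum_p(:\psi^{+,p}(z)\partial^n\gamma^{-,p}(z):-\eta:\partial^n(\psi^{+,p}(-z))\,\gamma^{-,p}(-z):)$. -/

import Mathlib

open scoped TensorProduct Polynomial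

noncomputable section

namespace SuperW

/-! ### The Lie superalgebra of differential operators on the supercircle -/

/-- Regular differential operators on the supercircle, as `2 × 2` matrices over the regular
differential operators on the circle.  `Finsupp.single k F` is `t^k F(D)`, where `D = t ∂_t`
and `F` is a matrix of polynomials.  Index `0` is even (spanned by `1`), index `1` is odd (spanned
by `θ`), so the matrix units are `M₀ = E₀₀ = ∂_θ θ`, `M₊ = E₀₁ = ∂_θ`, `M₋ = E₁₀ = θ`,
`M₁ = E₁₁ = θ ∂_θ`. -/
abbrev SD : Type := ℤ →₀ Matrix (Fin 2) (Fin 2) ℂ[X]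

/-- `t^k f(D) M_{ab}`. -/
def mono (k : ℤ) (a b : Fin 2) (f : ℂ[X]) : SD := Finsupp.single k (Matrix.single a b f)

/-- `f(w) ↦ f(w + s)`. -/
def transl (s : ℤ) (f : ℂ[X]) : ℂ[X] := f.comp (Polynomial.X + Polynomial.C (s : ℂ))

/-- `F(D) ↦ F(D + s)`. -/
def shift (s : ℤ) (F : Matrix (Fin 2) (Fin 2) ℂ[X]) : Matrix (Fin 2) (Fin 2) ℂ[X] :=
  F.map (transl s)

/-- Composition of differential operators: `t^r F(D) · t^s G(D) = t^(r+s) F(D+s) G(D)`. -/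
def mul (A B : SD) : SD :=
  A.sum fun r F => B.sum fun s G => Finsupp.single (r + s) (shift s F * G)

/-- The part of parity `p`; the entry `(a, b)` of a supermatrix has parity `a + b` mod `2`. -/
def part (p : Fin 2) (A : SD) : SD :=
  A.sum fun r F => Finsupp.single r (Matrix.of fun a b => if a + b = p then F a b else 0)

/-- The Koszul sign `(-1)^(pq)`. -/
def koszul (p q : Fin 2) : ℂ := (-1) ^ (p.val * q.val)

/-- The super-bracket, `AB - (-1)^(|A||B|) BA` on homogeneous elements. -/
def sbr (A B : SD) : SD :=
  ∑ p : Fin 2, ∑ q : Fin 2,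
    (mul (part p A) (part q B) - koszul p q • mul (part q B) (part p A))

/-- Supertrace of the number matrix `F(x) G(y)`. -/
def strEval (F G : Matrix (Fin 2) (Fin 2) ℂ[X]) (x y : ℂ) : ℂ :=
  let N : Matrix (Fin 2) (Fin 2) ℂ := F.map (Polynomial.eval x) * G.map (Polynomial.eval y)
  N 0 0 - N 1 1

/-- The two-cocycle.  For `r + s = 0`, `r ≥ 0` it is `∑_{-r ≤ j ≤ -1} Str (F(j) G(j+r))`; the value
for `r < 0` is the one forced by super skew-symmetry. -/
def cocycle (A B : SD) : ℂ :=
  A.sum fun r F => B.sum fun s G =>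
    if r + s = 0 then
      if 0 ≤ r then ∑ j ∈ Finset.Ico (-r) 0, strEval F G (j : ℂ) ((j + r : ℤ) : ℂ)
      else -∑ j ∈ Finset.Ico 0 (-r), strEval F G (j : ℂ) ((j + r : ℤ) : ℂ)
    else 0

/-- The central extension; `(A, c)` is `A + c C`. -/
abbrev HatSD : Type := SD × ℂ

/-- The bracket of the central extension. -/
def hatBr (x y : HatSD) : HatSD := (sbr x.1 y.1, cocycle x.1 y.1)

/-- The central element `C`. -/
def central : HatSD := (0, 1)

/-- An element of the superalgebra of differential operators as an element of the extension. -/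
def toHat (A : SD) : HatSD := (A, 0)

/-- Homogeneous of parity `p`; the central element is even. -/
def IsHomog (p : Fin 2) (x : HatSD) : Prop := part p x.1 = x.1 ∧ (p = 1 → x.2 = 0)

/-! ### Anti-involutions and the subalgebras that they fix up to sign -/

/-- A sign as a complex number. -/
def sg (ε : ℤˣ) : ℂ := ((ε : ℤ) : ℂ)

/-- `f(w) ↦ f(-w - c)`. -/
def refl (c : ℤ) (f : ℂ[X]) : ℂ[X] := f.comp (-Polynomial.X - Polynomial.C (c : ℂ))

/-- The anti-involution with `t ↦ -t`, `D ↦ -D - 1 + ∂_θ θ`, `θ ↦ t ∂_θ`, `∂_θ ↦ -t⁻¹ θ`, in the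
basis: `t^k f M₀ ↦ (-t)^k f(-D-k) M₀`, `t^k f M₁ ↦ (-t)^k f(-D-k-1) M₁`,
`t^k f M₋ ↦ (-1)^k t^(k+1) f(-D-k-1) M₊`, `t^k f M₊ ↦ (-1)^(k-1) t^(k-1) f(-D-k) M₋`. -/
def sigmaZero : SD →ₗ[ℂ] SD :=
  Finsupp.lsum ℂ fun k : ℤ =>
    { toFun := fun F => sg ((-1) ^ k) •
        (mono k 0 0 (refl k (F 0 0)) + mono k 1 1 (refl (k + 1) (F 1 1))
          + mono (k + 1) 0 1 (refl (k + 1) (F 1 0)) - mono (k - 1) 1 0 (refl k (F 0 1)))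
      map_add' := fun F G => by
        simp only [mono, refl, Matrix.add_apply, Polynomial.add_comp, Matrix.single_add,
          Finsupp.single_add, smul_add, smul_sub]
        abel
      map_smul' := fun c F => by
        simp only [mono, refl, Matrix.smul_apply, Polynomial.smul_comp, ← Matrix.smul_single,
          ← Finsupp.smul_single, smul_add, smul_sub, RingHom.id_apply, smul_comm c] }

/-- For signs `ε`, `η`: the anti-involution with `t ↦ ε t`, `D ↦ -D - 1`, `θ ↦ η θ`,
`∂_θ ↦ -η ∂_θ`, in the basis: it exchanges `M₀` and `M₁`, multiplies `M₋` by `η` and `M₊` by `-η`,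
and sends the coefficient `t^k f(D)` to `(ε t)^k f(-D-k-1)`. -/
def sigmaSign (ε η : ℤˣ) : SD →ₗ[ℂ] SD :=
  Finsupp.lsum ℂ fun k : ℤ =>
    { toFun := fun F => sg (ε ^ k) •
        (mono k 1 1 (refl (k + 1) (F 0 0)) + mono k 0 0 (refl (k + 1) (F 1 1))
          + sg η • mono k 1 0 (refl (k + 1) (F 1 0)) - sg η • mono k 0 1 (refl (k + 1) (F 0 1)))
      map_add' := fun F G => by
        simp only [mono, refl, Matrix.add_apply, Polynomial.add_comp, Matrix.single_add,
          Finsupp.single_add, smul_add, smul_sub]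
        abel
      map_smul' := fun c F => by
        simp only [mono, refl, Matrix.smul_apply, Polynomial.smul_comp, ← Matrix.smul_single,
          ← Finsupp.smul_single, smul_add, smul_sub, RingHom.id_apply, smul_comm c] }

theorem mul_mono (r s : ℤ) (a b c d : Fin 2) (f g : ℂ[X]) :
    mul (mono r a b f) (mono s c d g) =
      if b = c then mono (r + s) a d (transl s f * g) else 0 := by
  have h : shift s (Matrix.single a b f)
      = Matrix.single a b (transl s f) := by
    ext i j : 2
    simp only [shift, Matrix.map_apply, Matrix.single_apply]
    split_ifs <;> simp [transl]
  unfold mul mono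
  rw [Finsupp.sum_single_index (by simp [shift, transl]), Finsupp.sum_single_index (by simp), h]
  split_ifs with hbc
  · subst hbc
    rw [Matrix.single_mul_single_same]
  · rw [Matrix.single_mul_single_of_ne _ _ _ _ hbc, Finsupp.single_zero]

theorem refl_zero (c : ℤ) : refl c 0 = 0 := by simp [refl]

theorem mono_zero (k : ℤ) (a b : Fin 2) : mono k a b 0 = 0 := by simp [mono]

theorem mono_add (k : ℤ) (a b : Fin 2) (f g : ℂ[X]) :
    mono k a b (f + g) = mono k a b f + mono k a b g := by
  simp [mono, Matrix.single_add]

theorem mono_neg (k : ℤ) (a b : Fin 2) (f : ℂ[X]) : mono k a b (-f) = -mono k a b f := by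
  rw [eq_neg_iff_add_eq_zero, ← mono_add, neg_add_cancel, mono_zero]

theorem sigmaZero_mono (k : ℤ) (f : ℂ[X]) :
    sigmaZero (mono k 0 0 f) = sg ((-1) ^ k) • mono k 0 0 (refl k f) ∧
    sigmaZero (mono k 1 1 f) = sg ((-1) ^ k) • mono k 1 1 (refl (k + 1) f) ∧
    sigmaZero (mono k 1 0 f) = sg ((-1) ^ k) • mono (k + 1) 0 1 (refl (k + 1) f) ∧
    sigmaZero (mono k 0 1 f) = -sg ((-1) ^ k) • mono (k - 1) 1 0 (refl k f) := by
  refine ⟨?_, ?_, ?_, ?_⟩ <;>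
    (rw [mono, sigmaZero, Finsupp.lsum_single]; simp [refl_zero, mono_zero])

theorem sigmaSign_mono (ε η : ℤˣ) (k : ℤ) (f : ℂ[X]) :
    sigmaSign ε η (mono k 0 0 f) = sg (ε ^ k) • mono k 1 1 (refl (k + 1) f) ∧
    sigmaSign ε η (mono k 1 1 f) = sg (ε ^ k) • mono k 0 0 (refl (k + 1) f) ∧
    sigmaSign ε η (mono k 1 0 f) = (sg (ε ^ k) * sg η) • mono k 1 0 (refl (k + 1) f) ∧
    sigmaSign ε η (mono k 0 1 f) = -(sg (ε ^ k) * sg η) • mono k 0 1 (refl (k + 1) f) := by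
  refine ⟨?_, ?_, ?_, ?_⟩ <;>
    (rw [mono, sigmaSign, Finsupp.lsum_single]; simp [refl_zero, mono_zero, smul_smul])

theorem sg_mul (ε η : ℤˣ) : sg (ε * η) = sg ε * sg η := by simp [sg]

theorem sg_sq (ε : ℤˣ) : sg ε * sg ε = 1 := by
  rw [← sg_mul, Int.units_mul_self]; simp [sg]

theorem mul_smul_left (c : ℂ) (A B : SD) : mul (c • A) B = c • mul A B := by
  unfold mul
  rw [Finsupp.sum_smul_index' (by simp [shift, transl]), Finsupp.smul_sum]
  refine Finsupp.sum_congr fun r _ => ?_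
  rw [Finsupp.smul_sum]
  refine Finsupp.sum_congr fun s _ => ?_
  rw [Finsupp.smul_single, ← Matrix.smul_mul]
  congr 2
  ext i j : 2
  simp [shift, transl]

theorem mul_smul_right (c : ℂ) (A B : SD) : mul A (c • B) = c • mul A B := by
  unfold mul
  rw [Finsupp.smul_sum]
  refine Finsupp.sum_congr fun r _ => ?_
  rw [Finsupp.sum_smul_index' (by simp), Finsupp.smul_sum]
  refine Finsupp.sum_congr fun s _ => ?_
  rw [Finsupp.smul_single, Matrix.mul_smul]

theorem mul_neg_left (A B : SD) : mul (-A) B = -mul A B := by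
  simpa using mul_smul_left (-1) A B

theorem mul_neg_right (A B : SD) : mul A (-B) = -mul A B := by
  simpa using mul_smul_right (-1) A B

theorem refl_mul_comp (c s : ℤ) (f g : ℂ[X]) :
    refl c (transl s f * g) =
      refl c g * refl (c - s) f := by
  simp only [refl, transl, Polynomial.mul_comp, Polynomial.comp_assoc]
  rw [mul_comm]
  congr 2
  simp
  ring

theorem refl_comp (c s : ℤ) (f : ℂ[X]) :
    transl s (refl c f) = refl (c + s) f := by
  simp only [refl, transl, Polynomial.comp_assoc]
  congr 1
  simp
  ring

theorem refl_refl (c : ℤ) (f : ℂ[X]) : refl c (refl c f) = f := by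
  simp only [refl, Polynomial.comp_assoc]
  simp

/-- `sigmaZero` reverses products up to the Koszul sign. -/
theorem sigmaZero_mul (r s : ℤ) (a b c d : Fin 2) (f g : ℂ[X]) :
    sigmaZero (mul (mono r a b f) (mono s c d g)) =
      koszul (a + b) (c + d) • mul (sigmaZero (mono s c d g)) (sigmaZero (mono r a b f)) := by
  have h1 := fun k f => (sigmaZero_mono k f).1
  have h2 := fun k f => (sigmaZero_mono k f).2.1
  have h3 := fun k f => (sigmaZero_mono k f).2.2.1
  have h4 := fun k f => (sigmaZero_mono k f).2.2.2
  have e : sg ((-1) ^ (r + s)) = sg ((-1) ^ r) * sg ((-1) ^ s) := by rw [zpow_add, sg_mul]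
  rw [mul_mono]
  fin_cases a <;> fin_cases b <;> fin_cases c <;> fin_cases d <;>
    simp [h1, h2, h3, h4, mul_smul_left, mul_smul_right, mul_neg_left, mul_neg_right, mul_mono,
      koszul, e, smul_smul, refl_mul_comp, refl_comp] <;>
    ring_nf

/-- `sigmaSign ε η` reverses products up to the Koszul sign. -/
theorem sigmaSign_mul (ε η : ℤˣ) (r s : ℤ) (a b c d : Fin 2) (f g : ℂ[X]) :
    sigmaSign ε η (mul (mono r a b f) (mono s c d g)) =
      koszul (a + b) (c + d) •
        mul (sigmaSign ε η (mono s c d g)) (sigmaSign ε η (mono r a b f)) := by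
  have h1 := fun k f => (sigmaSign_mono ε η k f).1
  have h2 := fun k f => (sigmaSign_mono ε η k f).2.1
  have h3 := fun k f => (sigmaSign_mono ε η k f).2.2.1
  have h4 := fun k f => (sigmaSign_mono ε η k f).2.2.2
  have e : sg (ε ^ (r + s)) = sg (ε ^ r) * sg (ε ^ s) := by rw [zpow_add, sg_mul]
  have q : sg η ^ 2 = 1 := by rw [sq, sg_sq]
  rw [mul_mono]
  fin_cases a <;> fin_cases b <;> fin_cases c <;> fin_cases d <;>
    simp [h1, h2, h3, h4, mul_smul_left, mul_smul_right, mul_neg_left, mul_neg_right, mul_mono,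
      koszul, e, smul_smul, refl_mul_comp, refl_comp] <;>
    ring_nf <;> simp [q]

/-- `sigmaZero` is an involution. -/
theorem sigmaZero_sigmaZero (k : ℤ) (a b : Fin 2) (f : ℂ[X]) :
    sigmaZero (sigmaZero (mono k a b f)) = mono k a b f := by
  have h1 := fun k f => (sigmaZero_mono k f).1
  have h2 := fun k f => (sigmaZero_mono k f).2.1
  have h3 := fun k f => (sigmaZero_mono k f).2.2.1
  have h4 := fun k f => (sigmaZero_mono k f).2.2.2
  have e1 : sg ((-1) ^ (k + 1)) = -sg ((-1) ^ k) := by rw [zpow_add, sg_mul]; simp [sg]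
  have e2 : sg ((-1) ^ (k - 1)) = -sg ((-1) ^ k) := by rw [zpow_sub, sg_mul]; simp [sg]
  fin_cases a <;> fin_cases b <;>
    simp [h1, h2, h3, h4, e1, e2, smul_smul, sg_sq, refl_refl]

/-- `sigmaSign ε η` is an involution. -/
theorem sigmaSign_sigmaSign (ε η : ℤˣ) (k : ℤ) (a b : Fin 2) (f : ℂ[X]) :
    sigmaSign ε η (sigmaSign ε η (mono k a b f)) = mono k a b f := by
  have h1 := fun k f => (sigmaSign_mono ε η k f).1
  have h2 := fun k f => (sigmaSign_mono ε η k f).2.1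
  have h3 := fun k f => (sigmaSign_mono ε η k f).2.2.1
  have h4 := fun k f => (sigmaSign_mono ε η k f).2.2.2
  have e : (sg (ε ^ k) * sg η) * (sg (ε ^ k) * sg η) = 1 := by
    rw [mul_mul_mul_comm, sg_sq, sg_sq, one_mul]
  fin_cases a <;> fin_cases b <;>
    simp [h1, h2, h3, h4, e, smul_smul, sg_sq, refl_refl]

/-- The values of `sigmaZero` on `t`, `D`, `θ` and `∂_θ`. -/
theorem sigmaZero_gen :
    sigmaZero (mono 1 0 0 1 + mono 1 1 1 1) = -(mono 1 0 0 1 + mono 1 1 1 1) ∧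
    sigmaZero (mono 0 0 0 Polynomial.X + mono 0 1 1 Polynomial.X) =
      -(mono 0 0 0 Polynomial.X + mono 0 1 1 Polynomial.X) - (mono 0 0 0 1 + mono 0 1 1 1)
        + mono 0 0 0 1 ∧
    sigmaZero (mono 0 1 0 1) = mono 1 0 1 1 ∧
    sigmaZero (mono 0 0 1 1) = -mono (-1) 1 0 1 := by
  have h1 := fun k f => (sigmaZero_mono k f).1
  have h2 := fun k f => (sigmaZero_mono k f).2.1
  have h3 := fun k f => (sigmaZero_mono k f).2.2.1
  have h4 := fun k f => (sigmaZero_mono k f).2.2.2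
  refine ⟨?_, ?_, ?_, ?_⟩
  · simp [h1, h2, refl, sg, add_comm]
  · simp [h1, h2, refl, sg, sub_eq_add_neg, mono_add, mono_neg]
    abel
  · simp [h3, refl, sg]
  · simp [h4, refl, sg]

/-- The values of `sigmaSign ε η` on `t`, `D`, `θ` and `∂_θ`. -/
theorem sigmaSign_gen (ε η : ℤˣ) :
    sigmaSign ε η (mono 1 0 0 1 + mono 1 1 1 1) = sg ε • (mono 1 0 0 1 + mono 1 1 1 1) ∧
    sigmaSign ε η (mono 0 0 0 Polynomial.X + mono 0 1 1 Polynomial.X) =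
      -(mono 0 0 0 Polynomial.X + mono 0 1 1 Polynomial.X) - (mono 0 0 0 1 + mono 0 1 1 1) ∧
    sigmaSign ε η (mono 0 1 0 1) = sg η • mono 0 1 0 1 ∧
    sigmaSign ε η (mono 0 0 1 1) = -sg η • mono 0 0 1 1 := by
  have h1 := fun k f => (sigmaSign_mono ε η k f).1
  have h2 := fun k f => (sigmaSign_mono ε η k f).2.1
  have h3 := fun k f => (sigmaSign_mono ε η k f).2.2.1
  have h4 := fun k f => (sigmaSign_mono ε η k f).2.2.2
  refine ⟨?_, ?_, ?_, ?_⟩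
  · simp [h1, h2, refl, add_comm]
  · simp [h1, h2, refl, sg, sub_eq_add_neg, mono_add, mono_neg]
    abel
  · simp [h3, refl, sg]
  · simp [h4, refl, sg]

/-- For an anti-involution `σ`, the preimage in the central extension of the elements `e` with
`σ e = -e`. -/
def fixedHat (σ : SD →ₗ[ℂ] SD) : Submodule ℂ HatSD where
  carrier := {x | σ x.1 = -x.1}
  add_mem' := fun {x y} hx hy => by
    simp only [Set.mem_ofPred_eq, Prod.fst_add, map_add] at *
    rw [hx, hy]; abel
  zero_mem' := by simp
  smul_mem' := fun c x hx => by
    simp only [Set.mem_ofPred_eq, Prod.smul_fst, map_smul] at *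
    rw [hx, smul_neg]

/-- A graded subspace that is closed under the bracket. -/
def IsSubSuperalgebra (S : Submodule ℂ HatSD) : Prop :=
  (∀ x ∈ S, ∀ y ∈ S, hatBr x y ∈ S) ∧ ∀ x ∈ S, ∀ p, toHat (part p x.1) ∈ S

/-! ### The distinguished spanning elements -/

/-- `[w]_n = w (w-1) ⋯ (w-n+1)`. -/
def fallP (n : ℕ) : ℂ[X] := descPochhammer ℂ n

/-- `J^{ab,n}_k = -t^k [D]_n M_{ab}`, that is `-t^(n+k) ∂_t^n M_{ab}`. -/
def J (a b : Fin 2) (n : ℕ) (k : ℤ) : SD := -mono k a b (fallP n)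

/-- `t^k ([D]_n + (-1)^(k+1) [-D-k]_n) M₀`. -/
def wZero0 (n : ℕ) (k : ℤ) : SD :=
  mono k 0 0 (fallP n + sg ((-1) ^ (k + 1)) • refl k (fallP n))

/-- `t^k ([D]_n + (-1)^(k+1) [-D-k-1]_n) M₁`. -/
def wZero1 (n : ℕ) (k : ℤ) : SD :=
  mono k 1 1 (fallP n + sg ((-1) ^ (k + 1)) • refl (k + 1) (fallP n))

/-- `t^k [D]_n θ + (-1)^(k+1) t^(k+1) [-D-k-1]_n ∂_θ`. -/
def wZeroX (n : ℕ) (k : ℤ) : SD :=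
  mono k 1 0 (fallP n) + sg ((-1) ^ (k + 1)) • mono (k + 1) 0 1 (refl (k + 1) (fallP n))

/-- `t^k ([D]_n M₀ - ε^k [-D-k-1]_n M₁)`. -/
def wSign (ε : ℤˣ) (n : ℕ) (k : ℤ) : SD :=
  mono k 0 0 (fallP n) - sg (ε ^ k) • mono k 1 1 (refl (k + 1) (fallP n))

/-- `t^k ([D]_n - η ε^k [-D-k-1]_n) θ`. -/
def wSignPlus (ε η : ℤˣ) (n : ℕ) (k : ℤ) : SD :=
  mono k 1 0 (fallP n - (sg η * sg (ε ^ k)) • refl (k + 1) (fallP n))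

/-- `t^k ([D]_n + η ε^k [-D-k-1]_n) ∂_θ`. -/
def wSignMinus (ε η : ℤˣ) (n : ℕ) (k : ℤ) : SD :=
  mono k 0 1 (fallP n + (sg η * sg (ε ^ k)) • refl (k + 1) (fallP n))

/-! ### The Fock space of `l` copies of the `bc` and `βγ` fields -/

/-- Labels of the creation modes: the copy, the sign (`true` is `+`), and a number `n`.
For fermions `(p, +, n)` is `ψ^{+,p}_{-n-1}` and `(p, -, n)` is `ψ^{-,p}_{-n}`; for bosons
`(p, ±, n)` is `γ^{±,p}_{-n-1/2}`. -/
abbrev CIdx (l : ℕ) : Type := Fin l × Bool × ℕ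

/-- The Fock space: exterior algebra on the fermionic creation modes, tensored with the polynomial
algebra on the bosonic creation modes.  The vacuum vector is `1 ⊗ 1`. -/
def Fock (l : ℕ) : Type :=
  ExteriorAlgebra ℂ (CIdx l →₀ ℂ) ⊗[ℂ] MvPolynomial (CIdx l) ℂ

instance (l : ℕ) : AddCommGroup (Fock l) :=
  TensorProduct.addCommGroup (R := ℂ) (M := ExteriorAlgebra ℂ (CIdx l →₀ ℂ))
    (N := MvPolynomial (CIdx l) ℂ)

instance (l : ℕ) : Module ℂ (Fock l) :=
  TensorProduct.leftModule (R := ℂ) (M := ExteriorAlgebra ℂ (CIdx l →₀ ℂ))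
    (N := MvPolynomial (CIdx l) ℂ)

/-- The vector `x ⊗ y`. -/
def tens {l : ℕ} (x : ExteriorAlgebra ℂ (CIdx l →₀ ℂ)) (y : MvPolynomial (CIdx l) ℂ) : Fock l :=
  x ⊗ₜ[ℂ] y

/-- The operator `f ⊗ g`. -/
def tensMap {l : ℕ} (f : Module.End ℂ (ExteriorAlgebra ℂ (CIdx l →₀ ℂ)))
    (g : Module.End ℂ (MvPolynomial (CIdx l) ℂ)) : Module.End ℂ (Fock l) :=
  TensorProduct.map (R := ℂ) f g

theorem tensMap_tens {l : ℕ} (f : Module.End ℂ (ExteriorAlgebra ℂ (CIdx l →₀ ℂ)))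
    (g : Module.End ℂ (MvPolynomial (CIdx l) ℂ)) (x : ExteriorAlgebra ℂ (CIdx l →₀ ℂ))
    (y : MvPolynomial (CIdx l) ℂ) : tensMap f g (tens x y) = tens (f x) (g y) := rfl

theorem Fock.ext {l : ℕ} {f g : Module.End ℂ (Fock l)}
    (h : ∀ x y, f (tens x y) = g (tens x y)) : f = g :=
  TensorProduct.ext' (R := ℂ) h

theorem tensMap_mul {l : ℕ} (f f' : Module.End ℂ (ExteriorAlgebra ℂ (CIdx l →₀ ℂ)))
    (g g' : Module.End ℂ (MvPolynomial (CIdx l) ℂ)) :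
    tensMap f g * tensMap f' g' = tensMap (f * f') (g * g') := Fock.ext fun _ _ => rfl

theorem tensMap_one {l : ℕ} : tensMap 1 1 = (1 : Module.End ℂ (Fock l)) :=
  Fock.ext fun _ _ => rfl

theorem tensMap_add_left {l : ℕ} (f f' : Module.End ℂ (ExteriorAlgebra ℂ (CIdx l →₀ ℂ)))
    (g : Module.End ℂ (MvPolynomial (CIdx l) ℂ)) :
    tensMap (f + f') g = tensMap f g + tensMap f' g :=
  Fock.ext fun _ _ => TensorProduct.add_tmul _ _ _

theorem tensMap_sub_right {l : ℕ} (f : Module.End ℂ (ExteriorAlgebra ℂ (CIdx l →₀ ℂ)))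
    (g g' : Module.End ℂ (MvPolynomial (CIdx l) ℂ)) :
    tensMap f (g - g') = tensMap f g - tensMap f g' :=
  Fock.ext fun _ _ => TensorProduct.tmul_sub _ _ _

theorem tensMap_zero_left {l : ℕ} (g : Module.End ℂ (MvPolynomial (CIdx l) ℂ)) :
    tensMap 0 g = (0 : Module.End ℂ (Fock l)) := Fock.ext fun _ _ => TensorProduct.zero_tmul _ _

theorem tensMap_zero_right {l : ℕ} (f : Module.End ℂ (ExteriorAlgebra ℂ (CIdx l →₀ ℂ))) :
    tensMap f 0 = (0 : Module.End ℂ (Fock l)) := Fock.ext fun _ _ => TensorProduct.tmul_zero _ _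

/-- The vacuum vector. -/
def vac (l : ℕ) : Fock l := tens 1 1

/-- The modes: `psi s p m` is `ψ^{s,p}_m`, and `gam s p m` is `γ^{s,p}_{m + 1/2}`. -/
inductive Mode (l : ℕ) : Type
  | psi (s : Bool) (p : Fin l) (m : ℤ)
  | gam (s : Bool) (p : Fin l) (m : ℤ)

/-- Annihilation modes: `ψ^+_m` (`m ≥ 0`), `ψ^-_m` (`m ≥ 1`), `γ^±_r` (`r ≥ 1/2`). -/
def Mode.ann {l : ℕ} : Mode l → Bool
  | .psi true _ m => decide (0 ≤ m)
  | .psi false _ m => decide (1 ≤ m)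
  | .gam _ _ m => decide (0 ≤ m)

/-- Parity: the `ψ` are odd and the `γ` are even. -/
def Mode.parity {l : ℕ} : Mode l → Fin 2
  | .psi _ _ _ => 1
  | .gam _ _ _ => 0

/-- Exterior multiplication by a fermionic creation mode. -/
def fermCr {l : ℕ} (c : CIdx l) : Module.End ℂ (Fock l) :=
  tensMap (LinearMap.mulLeft ℂ (ExteriorAlgebra.ι ℂ (Finsupp.single c 1))) 1

/-- Contraction against a fermionic creation mode. -/
def fermAn {l : ℕ} (c : CIdx l) : Module.End ℂ (Fock l) :=
  tensMap (CliffordAlgebra.contractLeft (Finsupp.lapply c)) 1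

/-- Multiplication by a bosonic creation mode. -/
def bosCr {l : ℕ} (c : CIdx l) : Module.End ℂ (Fock l) :=
  tensMap 1 (LinearMap.mulLeft ℂ (MvPolynomial.X c))

/-- Partial derivative with respect to a bosonic creation mode. -/
def bosAn {l : ℕ} (c : CIdx l) : Module.End ℂ (Fock l) :=
  tensMap 1 (MvPolynomial.pderiv c).toLinearMap

/-- The action of the modes on the Fock space. -/
def Mode.op {l : ℕ} : Mode l → Module.End ℂ (Fock l)
  | .psi true p m => if 0 ≤ m then fermAn (p, false, m.toNat) else fermCr (p, true, (-m - 1).toNat)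
  | .psi false p m => if 1 ≤ m then fermAn (p, true, (m - 1).toNat) else fermCr (p, false, (-m).toNat)
  | .gam true p m => if 0 ≤ m then bosAn (p, false, m.toNat) else bosCr (p, true, (-m - 1).toNat)
  | .gam false p m => if 0 ≤ m then -bosAn (p, true, m.toNat) else bosCr (p, false, (-m - 1).toNat)

/-- The relations `[ψ^{+,p}_m, ψ^{-,q}_n]_+ = δ_{pq} δ_{m+n,0}`. -/
theorem psi_rel {l : ℕ} (p q : Fin l) (m n : ℤ) :
    (Mode.psi true p m).op * (Mode.psi false q n).op
      + (Mode.psi false q n).op * (Mode.psi true p m).op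
      = if p = q ∧ m + n = 0 then 1 else 0 := by
  have hac : ∀ a b : CIdx l, fermAn a * fermCr b + fermCr b * fermAn a
      = if a = b then 1 else 0 := by
    intro a b
    simp only [fermAn, fermCr, tensMap_mul, ← tensMap_add_left, mul_one]
    split_ifs with h
    · rw [← tensMap_one]
      congr 1
      refine LinearMap.ext fun x => ?_
      simp only [LinearMap.add_apply, Module.End.mul_apply, LinearMap.mulLeft_apply]
      erw [CliffordAlgebra.contractLeft_ι_mul]
      simp [h]
    · rw [← tensMap_zero_left 1]
      congr 1
      refine LinearMap.ext fun x => ?_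
      simp only [LinearMap.add_apply, Module.End.mul_apply, LinearMap.mulLeft_apply]
      erw [CliffordAlgebra.contractLeft_ι_mul]
      simp [Ne.symm h]
  have haa : ∀ a b : CIdx l, fermAn a * fermAn b + fermAn b * fermAn a = 0 := by
    intro a b
    simp only [fermAn, tensMap_mul, ← tensMap_add_left, mul_one]
    rw [← tensMap_zero_left 1]
    congr 1
    refine LinearMap.ext fun x => ?_
    simp only [LinearMap.add_apply, Module.End.mul_apply]
    rw [CliffordAlgebra.contractLeft_comm]
    simp
  have hcc : ∀ a b : CIdx l, fermCr a * fermCr b + fermCr b * fermCr a = 0 := by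
    intro a b
    simp only [fermCr, tensMap_mul, ← tensMap_add_left, mul_one]
    rw [← tensMap_zero_left 1]
    congr 1
    refine LinearMap.ext fun x => ?_
    simp only [LinearMap.add_apply, Module.End.mul_apply, LinearMap.mulLeft_apply, ← mul_assoc,
      ← add_mul]
    simp [ExteriorAlgebra.ι_add_mul_swap]
  simp only [Mode.op]
  split_ifs with h1 h2 h3 h3 h3 h3
  all_goals first
    | rw [haa]
    | rw [hcc]
    | rw [hac]
    | (rw [add_comm, hac])
  all_goals (try simp only [Prod.mk.injEq, true_and])
  all_goals grind

/-- The relations `[γ^{+,p}_r, γ^{-,q}_s] = δ_{pq} δ_{r+s,0}`, with `r = m + 1/2`, `s = n + 1/2`. -/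
theorem gam_rel {l : ℕ} (p q : Fin l) (m n : ℤ) :
    (Mode.gam true p m).op * (Mode.gam false q n).op
      - (Mode.gam false q n).op * (Mode.gam true p m).op
      = if p = q ∧ m + n + 1 = 0 then 1 else 0 := by
  have hac : ∀ a b : CIdx l, bosAn a * bosCr b - bosCr b * bosAn a
      = if a = b then 1 else 0 := by
    intro a b
    simp only [bosAn, bosCr, tensMap_mul, ← tensMap_sub_right, mul_one]
    split_ifs with h
    · rw [← tensMap_one]
      congr 1
      refine LinearMap.ext fun x => ?_
      simp [h]
    · rw [← tensMap_zero_right 1]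
      congr 1
      refine LinearMap.ext fun x => ?_
      simp [MvPolynomial.pderiv_X, Ne.symm h]
  have haa : ∀ a b : CIdx l, bosAn a * bosAn b - bosAn b * bosAn a = 0 := by
    intro a b
    have hd : ⁅MvPolynomial.pderiv (R := ℂ) a, MvPolynomial.pderiv (R := ℂ) b⁆ = 0 := by
      refine MvPolynomial.derivation_ext fun i => ?_
      rw [Derivation.commutator_apply]
      classical
      simp only [MvPolynomial.pderiv_X, Derivation.coe_zero, Pi.zero_apply, Pi.single_apply]
      split_ifs <;> simp
    simp only [bosAn, tensMap_mul, ← tensMap_sub_right, mul_one]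
    rw [← tensMap_zero_right 1]
    congr 1
    refine LinearMap.ext fun x => ?_
    have hy := Derivation.congr_fun hd x
    rwa [Derivation.commutator_apply] at hy
  have hcc : ∀ a b : CIdx l, bosCr a * bosCr b - bosCr b * bosCr a = 0 := by
    intro a b
    simp only [bosCr, tensMap_mul, ← tensMap_sub_right, mul_one]
    rw [← tensMap_zero_right 1]
    congr 1
    refine LinearMap.ext fun x => ?_
    simp [mul_left_comm]
  simp only [Mode.op]
  split_ifs with h1 h2 h3 h3 h3 h3
  all_goals try simp only [mul_neg, neg_mul, sub_neg_eq_add, neg_add_eq_sub]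
  all_goals first
    | rw [haa]
    | rw [hcc]
    | rw [hac]
  all_goals (try simp only [Prod.mk.injEq, true_and])
  all_goals grind

/-- The annihilation modes kill the vacuum. -/
theorem ann_vac {l : ℕ} (u : Mode l) (h : u.ann = true) : u.op (vac l) = 0 := by
  have h0 : ∀ y : MvPolynomial (CIdx l) ℂ, tens 0 y = 0 := TensorProduct.zero_tmul _
  have h1 : ∀ x : ExteriorAlgebra ℂ (CIdx l →₀ ℂ), tens x 0 = 0 := fun x =>
    TensorProduct.tmul_zero _ x
  rcases u with ⟨_ | _, p, m⟩ | ⟨_ | _, p, m⟩ <;> simp only [Mode.ann, decide_eq_true_eq] at h <;>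
    simp [Mode.op, h, vac, fermAn, bosAn, tensMap_tens, h0, h1]

/-- The parity operator of the Fock space, `(-1)` to the number of fermions. -/
def parityOp (l : ℕ) : Module.End ℂ (Fock l) :=
  tensMap (CliffordAlgebra.involute (Q := (0 : QuadraticForm ℂ (CIdx l →₀ ℂ)))).toLinearMap 1

/-- Normal ordering of two modes: the annihilation modes are moved to the right. -/
def nord {l : ℕ} (u v : Mode l) : Module.End ℂ (Fock l) :=
  if u.ann && !v.ann then koszul u.parity v.parity • (v.op * u.op) else u.op * v.op

/-! ### Locally finite sums of operators -/

/-- Every vector is killed by all but finitely many of the operators. -/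
def LocFin {ι V : Type*} [AddCommGroup V] [Module ℂ V] (f : ι → Module.End ℂ V) : Prop :=
  ∀ v, (Function.support fun i => f i v).Finite

open Classical in
/-- The sum of a locally finite family of operators (`0` if the family is not locally finite). -/
def locSum {ι V : Type*} [AddCommGroup V] [Module ℂ V] (f : ι → Module.End ℂ V) :
    Module.End ℂ V :=
  if h : LocFin f then
    { toFun := fun v => ∑ᶠ i, f i v
      map_add' := fun v w => by
        simp only [map_add]
        exact finsum_add_distrib (h v) (h w)
      map_smul' := fun c v => by
        simp only [map_smul, RingHom.id_apply]
        exact (smul_finsum' c (h v)).symm }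
  else 0

/-! ### Free fields and their normally ordered products -/

/-- A linear combination of modes for every power of `z`: `a m` is the coefficient of `z^m`. -/
abbrev FField (l : ℕ) : Type := ℤ → (Mode l →₀ ℂ)

/-- A two-sided formal series in `z` with operator coefficients: `a m` is the coefficient
of `z^m`. -/
abbrev OpSeries (l : ℕ) : Type := ℤ → Module.End ℂ (Fock l)

/-- `ψ^{+,p}(z) = ∑ ψ^{+,p}_n z^(-n-1)`. -/
def psiP {l : ℕ} (p : Fin l) : FField l := fun m => Finsupp.single (.psi true p (-m - 1)) 1

/-- `ψ^{-,p}(z) = ∑ ψ^{-,p}_n z^(-n)`. -/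
def psiM {l : ℕ} (p : Fin l) : FField l := fun m => Finsupp.single (.psi false p (-m)) 1

/-- `γ^{+,p}(z) = ∑ γ^{+,p}_r z^(-r-1/2)`. -/
def gamP {l : ℕ} (p : Fin l) : FField l := fun m => Finsupp.single (.gam true p (-m - 1)) 1

/-- `γ^{-,p}(z) = ∑ γ^{-,p}_r z^(-r-1/2)`. -/
def gamM {l : ℕ} (p : Fin l) : FField l := fun m => Finsupp.single (.gam false p (-m - 1)) 1

/-- `∂ a(z)`, the derivative with respect to `z`. -/
def dz {l : ℕ} (a : FField l) : FField l := fun m => ((m : ℂ) + 1) • a (m + 1)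

/-- `z a(z)`. -/
def zmul {l : ℕ} (a : FField l) : FField l := fun m => a (m - 1)

/-- `a(-z)`. -/
def zneg {l : ℕ} (a : FField l) : FField l := fun m => sg ((-1) ^ m) • a m

/-- `z⁻¹ A(z)`. -/
def zinv {l : ℕ} (A : OpSeries l) : OpSeries l := fun m => A (m + 1)

/-- The fields that arise from the generating ones by `∂`, multiplication by `z`, and `z ↦ -z`. -/
inductive IsFree {l : ℕ} : FField l → Prop
  | psiP (p : Fin l) : IsFree (psiP p)
  | psiM (p : Fin l) : IsFree (psiM p)
  | gamP (p : Fin l) : IsFree (gamP p)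
  | gamM (p : Fin l) : IsFree (gamM p)
  | dz {a : FField l} : IsFree a → IsFree (dz a)
  | zmul {a : FField l} : IsFree a → IsFree (zmul a)
  | zneg {a : FField l} : IsFree a → IsFree (zneg a)

/-- Normal ordering, extended bilinearly to linear combinations of modes. -/
def nordLin {l : ℕ} (x y : Mode l →₀ ℂ) : Module.End ℂ (Fock l) :=
  x.sum fun u c => y.sum fun v d => (c * d) • nord u v

/-- The terms of the coefficient of `z^m` in `:a(z) b(z):`. -/
def nordTerms {l : ℕ} (a b : FField l) (m : ℤ) : ℤ → Module.End ℂ (Fock l) :=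
  fun i => nordLin (a i) (b (m - i))

/-- The normally ordered product `:a(z) b(z):`. -/
def nprod {l : ℕ} (a b : FField l) : OpSeries l := fun m => locSum (nordTerms a b m)

/-! ### The action -/

/-- Matrices indexed by the half-integers with finitely many nonzero diagonals.  The index `(0, i)`
is the integer `i`, the index `(1, i)` is the half-integer `i - 1/2`. -/
def GlInf : Type :=
  {A : Matrix (Fin 2 × ℤ) (Fin 2 × ℤ) ℂ // ∃ N : ℤ, ∀ x y, N < |x.2 - y.2| → A x y = 0}

/-- The mode `ψ^{+,p}_{-i}` or `γ^{+,p}_{-r}` that belongs to an index `i` or `r = i - 1/2`. -/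
def rowMode {l : ℕ} (p : Fin l) (x : Fin 2 × ℤ) : Mode l :=
  if x.1 = 0 then .psi true p (-x.2) else .gam true p (-x.2)

/-- The mode `ψ^{-,p}_j` or `γ^{-,p}_s` that belongs to an index `j` or `s = j - 1/2`. -/
def colMode {l : ℕ} (p : Fin l) (y : Fin 2 × ℤ) : Mode l :=
  if y.1 = 0 then .psi false p y.2 else .gam false p (y.2 - 1)

/-- The action of the elementary matrices: for `i`, `j` integers and `r`, `s` half-integers,
`E_{ij} = ∑_p :ψ^{+,p}_{-i} ψ^{-,p}_j:`, `E_{rs} = -∑_p :γ^{+,p}_{-r} γ^{-,p}_s:`,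
`E_{is} = ∑_p :ψ^{+,p}_{-i} γ^{-,p}_s:`, `E_{rj} = -∑_p :γ^{+,p}_{-r} ψ^{-,p}_j:`. -/
def elemOp (l : ℕ) (x y : Fin 2 × ℤ) : Module.End ℂ (Fock l) :=
  (if x.1 = 0 then (1 : ℂ) else -1) • ∑ p : Fin l, nord (rowMode p x) (colMode p y)

/-- The terms of the action of a matrix. -/
def glTerms (l : ℕ) (A : GlInf) : (Fin 2 × ℤ) × (Fin 2 × ℤ) → Module.End ℂ (Fock l) :=
  fun xy => A.1 xy.1 xy.2 • elemOp l xy.1 xy.2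

/-- The action on the Fock space of the central extension of the matrix algebra, whose elements
are `(A, c) = A + c 1`; the central charge is `l`. -/
def glAct (l : ℕ) (x : GlInf × ℂ) : Module.End ℂ (Fock l) :=
  locSum (glTerms l x.1) + (x.2 * (l : ℂ)) • 1

/-- The embedding `φ₀`: `t^k f(D) M_{ab} ↦ ∑_j f(-j) E_{j-k,j} M_{ab}`, the matrix of a differential
operator in the basis `v_i = t^(-i)`, `v_{i-1/2} = t^(-i) θ`. -/
def phi (A : SD) : GlInf :=
  ⟨fun x y => (A (y.2 - x.2) x.1 y.1).eval (-(y.2 : ℂ)), by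
    refine ⟨∑ k ∈ A.support, |k|, fun x y h => ?_⟩
    have h0 : A (y.2 - x.2) = 0 := by
      by_contra hne
      have := Finset.single_le_sum (f := fun k : ℤ => |k|) (fun k _ => abs_nonneg k)
        (Finsupp.mem_support_iff.mpr hne)
      simp only [abs_sub_comm y.2 x.2] at this
      omega
    simp [h0]⟩

/-- The lift of `φ₀` to the central extensions, `A + c C ↦ φ₀(A) + c 1`. -/
def phiHat (x : HatSD) : GlInf × ℂ := (phi x.1, x.2)

/-- The action of the central extension of the superalgebra of differential operators on the Fock
space, pulled back along the lift of `φ₀`. -/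
def act (l : ℕ) (x : HatSD) : Module.End ℂ (Fock l) := glAct l (phiHat x)

/-- Linear, parity preserving, and compatible with the super-brackets: a representation on the
superspace `Fock l`. -/
structure IsSuperRep (l : ℕ) (ρ : HatSD → Module.End ℂ (Fock l)) : Prop where
  linear : IsLinearMap ℂ ρ
  parity : ∀ p x, IsHomog p x → parityOp l * ρ x = (-1 : ℂ) ^ p.val • (ρ x * parityOp l)
  bracket : ∀ p q x y, IsHomog p x → IsHomog q y →
    ρ (hatBr x y) = ρ x * ρ y - koszul p q • (ρ y * ρ x)

/-- The generating function `∑_k W_k z^(-k-n-1)` of a family `W`, acting on the Fock space. -/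
def gen (l : ℕ) (n : ℕ) (W : ℤ → SD) : OpSeries l := fun m => act l (toHat (W (-m - n - 1)))

/-- The span of `C` and a family of elements. -/
def hatSpan (S : Set SD) : Submodule ℂ HatSD := Submodule.span ℂ (insert central (toHat '' S))

end SuperW

end

open SuperW

noncomputable section

namespace SuperW

/-! ### Locally finite sums -/

section LocSum

variable {ι κ V : Type*} [AddCommGroup V] [Module ℂ V]

/-! A differential operator acts on functions on the supercircle, and in the basis `t^(-i)`, `t^(-i)
θ` the monomial `t^k f(D) M_{ab}` is a matrix supported on one diagonal. It is therefore enough to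
know how the elementary matrices act and to sum along diagonals.

For the elementary matrices, the products of modes without normal ordering (`rawOp`) satisfy the
relations of the matrix superalgebra exactly (`rawOp_mul`); this is the Clifford–Weyl relations in
the uniform form `Mode.op_mul_op`. Normal ordering subtracts the scalar `vacVal`, so the bracket of
two normally ordered elementary matrices acquires the value of `vacVal` on the matrix bracket
(`elemOp_bracket`). Entry by entry this is a coboundary. Along a diagonal the unordered sums need
not be locally finite, but the difference of two step functions has finite support, and its sum is
the cocycle (`sum_cocycleTerm`). Local finiteness of everything rests on `exists_op_eq_zero`: a
given vector is killed by all sufficiently deep annihilation modes. Together these give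
`actS_bracket_mono`, and bilinearity gives the representation.

For the fields, a coefficient of a normally ordered product is again a sum along one diagonal
(`sum_nprod`). The `n`-th derivative produces a falling factorial (`dz_iterate`). If it falls on a
column field, the weight is `[D]_n`; if it falls on a row field, it is the reflected polynomial,
which is the one that the anti-involutions create. Replacing `z` by `-z` contributes a sign constant
on the diagonal, and multiplication by `z` moves to the neighbouring diagonal.

Finally, an anti-involution `σ` satisfies `σ[A,B] = -[σA,σB]`, so its `-1` eigenspace is closed
under the bracket. That eigenspace is the image of `1 - σ`. Since the `[D]_n` span the polynomials,
it is spanned by the images of the `t^k [D]_n M_{ab}`, and matrix units interchanged by `σ` need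
only one family. -/

theorem locSum_apply {f : ι → Module.End ℂ V} (hf : LocFin f) (v : V) :
    locSum f v = ∑ᶠ i, f i v := by
  simp only [locSum, dif_pos hf]; rfl

theorem LocFin.add {f g : ι → Module.End ℂ V} (hf : LocFin f) (hg : LocFin g) :
    LocFin (fun i => f i + g i) := fun v =>
  ((hf v).union (hg v)).subset (Function.support_add _ _)

theorem LocFin.smul {f : ι → Module.End ℂ V} (hf : LocFin f) (c : ι → ℂ) :
    LocFin (fun i => c i • f i) := fun v =>
  (hf v).subset fun i hi h => hi (by
    have h' : f i v = 0 := h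
    simp [h'])

theorem LocFin.sum {α : Type*} (s : Finset α) {f : α → ι → Module.End ℂ V}
    (hf : ∀ a, LocFin (f a)) : LocFin (fun i => ∑ a ∈ s, f a i) := fun v => by
  refine (Set.Finite.biUnion s.finite_toSet fun a _ => hf a v).subset fun i hi => ?_
  by_contra hn
  refine hi ?_
  simp only [Set.mem_iUnion, Function.mem_support, not_exists, not_not] at hn
  simp only [LinearMap.sum_apply]
  exact Finset.sum_eq_zero fun a ha => hn a ha

theorem LocFin.comp {f : ι → Module.End ℂ V} (hf : LocFin f) {e : κ → ι}
    (he : Function.Injective e) : LocFin (fun k => f (e k)) := fun v =>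
  (hf v).preimage he.injOn

/-- The right factor acts first: only finitely many `g j v` are nonzero, and each of these vectors
meets only finitely many `f i`. -/
theorem LocFin.mul {f : ι → Module.End ℂ V} {g : κ → Module.End ℂ V} (hf : LocFin f)
    (hg : LocFin g) : LocFin (fun x : ι × κ => f x.1 * g x.2) := fun v => by
  refine ((hg v).biUnion fun j _ => (hf (g j v)).prod (Set.finite_singleton j)).subset ?_
  rintro ⟨i, j⟩ hij
  simp only [Set.mem_iUnion]
  refine ⟨j, fun h => hij ?_, ?_⟩
  · have h' : g j v = 0 := h
    simp [h']
  · exact ⟨hij, rfl⟩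

theorem LocFin.zero : LocFin (fun _ : ι => (0 : Module.End ℂ V)) := fun v => by simp

theorem LocFin.of_finite {f : ι → Module.End ℂ V} (s : Finset ι) (h : ∀ i ∉ s, f i = 0) :
    LocFin f := fun v => by
  refine s.finite_toSet.subset fun i hi => ?_
  by_contra hn
  exact hi (by simp [h i hn])

theorem locSum_add {f g : ι → Module.End ℂ V} (hf : LocFin f) (hg : LocFin g) :
    locSum (fun i => f i + g i) = locSum f + locSum g := by
  ext v
  rw [locSum_apply (hf.add hg), LinearMap.add_apply, locSum_apply hf, locSum_apply hg]
  exact finsum_add_distrib (hf v) (hg v)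

theorem locSum_const_smul {f : ι → Module.End ℂ V} (hf : LocFin f) (c : ℂ) :
    locSum (fun i => c • f i) = c • locSum f := by
  ext v
  rw [locSum_apply (hf.smul fun _ => c), LinearMap.smul_apply, locSum_apply hf]
  exact (smul_finsum' c (hf v)).symm

theorem locSum_zero : locSum (fun _ : ι => (0 : Module.End ℂ V)) = 0 := by
  ext v
  rw [locSum_apply LocFin.zero]
  simp

theorem locSum_sum {α : Type*} (s : Finset α) {f : α → ι → Module.End ℂ V}
    (hf : ∀ a, LocFin (f a)) : locSum (fun i => ∑ a ∈ s, f a i) = ∑ a ∈ s, locSum (f a) := by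
  classical
  induction s using Finset.induction_on with
  | empty => simp [locSum_zero]
  | insert a s ha ih =>
    simp only [Finset.sum_insert ha]
    rw [locSum_add (hf a) (LocFin.sum s hf), ih]

/-- Reindexing along an injection whose range contains the support. -/
theorem locSum_comp {f : ι → Module.End ℂ V} {e : κ → ι} (hf : LocFin fun k => f (e k))
    (he : Function.Injective e) (h0 : ∀ i, i ∉ Set.range e → f i = 0) :
    LocFin f ∧ locSum f = locSum fun k => f (e k) := by
  have hl : LocFin f := fun v => by
    refine ((hf v).image e).subset fun i hi => ?_
    by_cases hr : i ∈ Set.range e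
    · obtain ⟨k, rfl⟩ := hr
      exact ⟨k, hi, rfl⟩
    · exact absurd (by simp [h0 i hr]) hi
  refine ⟨hl, ?_⟩
  ext v
  rw [locSum_apply hl, locSum_apply hf, ← finsum_mem_range he (f := fun i => f i v),
    ← finsum_mem_univ]
  refine finsum_mem_inter_support_eq' _ _ _ fun i hi => ?_
  simp only [Set.mem_univ, true_iff]
  by_contra hr
  exact hi (by simp [h0 i hr])

theorem locSum_equiv (e : κ ≃ ι) {f : ι → Module.End ℂ V} :
    locSum f = locSum fun k => f (e k) := by
  by_cases hf : LocFin f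
  · exact (locSum_comp (hf.comp e.injective) e.injective (by simp)).2
  -- Local finiteness transfers both ways along a bijection, so otherwise both sides take the
  -- default value `0`.
  · have hf' : ¬ LocFin fun k => f (e k) := fun h => hf (by simpa using h.comp e.symm.injective)
    simp only [locSum, dif_neg hf, dif_neg hf']

theorem LocFin.mul_left {f : ι → Module.End ℂ V} (hf : LocFin f) (T : Module.End ℂ V) :
    LocFin (fun i => T * f i) := fun v =>
  (hf v).subset fun i hi h => hi (by
    have h' : f i v = 0 := h
    simp [h'])

theorem locSum_mul_left {f : ι → Module.End ℂ V} (hf : LocFin f) (T : Module.End ℂ V) :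
    T * locSum f = locSum fun i => T * f i := by
  ext v
  rw [Module.End.mul_apply, locSum_apply hf, locSum_apply (hf.mul_left T)]
  exact T.toAddMonoidHom.map_finsum (hf v)

theorem LocFin.mul_right {f : ι → Module.End ℂ V} (hf : LocFin f) (T : Module.End ℂ V) :
    LocFin (fun i => f i * T) := fun v => hf (T v)

theorem locSum_mul_right {f : ι → Module.End ℂ V} (hf : LocFin f) (T : Module.End ℂ V) :
    locSum f * T = locSum fun i => f i * T := by
  ext v
  rw [Module.End.mul_apply, locSum_apply hf, locSum_apply (hf.mul_right T)]
  rfl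

theorem locSum_mul {f : ι → Module.End ℂ V} {g : κ → Module.End ℂ V} (hf : LocFin f)
    (hg : LocFin g) :
    locSum f * locSum g = locSum (fun x : ι × κ => f x.1 * g x.2) := by
  ext v
  rw [locSum_mul_left hg, locSum_apply (hg.mul_left _), locSum_apply (hf.mul hg)]
  -- The pairs are swapped so that currying puts the index of the right factor, which acts first, on
  -- the outer sum.
  have h := (hf.mul hg).comp (Equiv.prodComm κ ι).injective v
  have h2 := finsum_comp_equiv (Equiv.prodComm κ ι) (f := fun x : ι × κ => (f x.1 * g x.2) v)
  rw [← h2, finsum_curry _ h]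
  refine finsum_congr fun j => ?_
  rw [Module.End.mul_apply, locSum_apply hf]
  rfl

/-- A finite family. -/
theorem locSum_finite {f : ι → Module.End ℂ V} (s : Finset ι) (h : ∀ i ∉ s, f i = 0) :
    locSum f = ∑ i ∈ s, f i := by
  ext v
  rw [locSum_apply (LocFin.of_finite s h), LinearMap.sum_apply]
  refine finsum_eq_sum_of_support_subset _ fun i hi => ?_
  by_contra hn
  exact hi (by simp [h i hn])

end LocSum

/-! ### Relations between the modes -/

section Modes

variable {l : ℕ}

theorem tensMap_comm (f : Module.End ℂ (ExteriorAlgebra ℂ (CIdx l →₀ ℂ)))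
    (g : Module.End ℂ (MvPolynomial (CIdx l) ℂ)) :
    tensMap f 1 * tensMap 1 g = tensMap 1 g * tensMap f 1 := by
  rw [tensMap_mul, tensMap_mul]; simp

theorem fermAn_fermAn (a b : CIdx l) : fermAn a * fermAn b + fermAn b * fermAn a = 0 := by
  simp only [fermAn, tensMap_mul, ← tensMap_add_left, mul_one]
  rw [← tensMap_zero_left 1]
  congr 1
  refine LinearMap.ext fun x => ?_
  simp only [LinearMap.add_apply, Module.End.mul_apply]
  rw [CliffordAlgebra.contractLeft_comm]
  simp

theorem fermCr_fermCr (a b : CIdx l) : fermCr a * fermCr b + fermCr b * fermCr a = 0 := by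
  simp only [fermCr, tensMap_mul, ← tensMap_add_left, mul_one]
  rw [← tensMap_zero_left 1]
  congr 1
  refine LinearMap.ext fun x => ?_
  simp only [LinearMap.add_apply, Module.End.mul_apply, LinearMap.mulLeft_apply, ← mul_assoc,
    ← add_mul]
  simp [ExteriorAlgebra.ι_add_mul_swap]

theorem fermAn_fermCr_of_ne {a b : CIdx l} (h : a ≠ b) :
    fermAn a * fermCr b + fermCr b * fermAn a = 0 := by
  simp only [fermAn, fermCr, tensMap_mul, ← tensMap_add_left, mul_one]
  rw [← tensMap_zero_left 1]
  congr 1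
  refine LinearMap.ext fun x => ?_
  simp only [LinearMap.add_apply, Module.End.mul_apply, LinearMap.mulLeft_apply]
  erw [CliffordAlgebra.contractLeft_ι_mul]
  simp [Ne.symm h]

theorem bosAn_bosAn (a b : CIdx l) : bosAn a * bosAn b - bosAn b * bosAn a = 0 := by
  have hd : ⁅MvPolynomial.pderiv (R := ℂ) a, MvPolynomial.pderiv (R := ℂ) b⁆ = 0 := by
    refine MvPolynomial.derivation_ext fun i => ?_
    rw [Derivation.commutator_apply]
    classical
    simp only [MvPolynomial.pderiv_X, Derivation.coe_zero, Pi.zero_apply, Pi.single_apply]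
    split_ifs <;> simp
  simp only [bosAn, tensMap_mul, ← tensMap_sub_right, mul_one]
  rw [← tensMap_zero_right 1]
  congr 1
  refine LinearMap.ext fun x => ?_
  have hy := Derivation.congr_fun hd x
  rwa [Derivation.commutator_apply] at hy

theorem bosCr_bosCr (a b : CIdx l) : bosCr a * bosCr b - bosCr b * bosCr a = 0 := by
  simp only [bosCr, tensMap_mul, ← tensMap_sub_right, mul_one]
  rw [← tensMap_zero_right 1]
  congr 1
  refine LinearMap.ext fun x => ?_
  simp [mul_left_comm]

theorem bosAn_bosCr_of_ne {a b : CIdx l} (h : a ≠ b) :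
    bosAn a * bosCr b - bosCr b * bosAn a = 0 := by
  simp only [bosAn, bosCr, tensMap_mul, ← tensMap_sub_right, mul_one]
  rw [← tensMap_zero_right 1]
  congr 1
  refine LinearMap.ext fun x => ?_
  simp [MvPolynomial.pderiv_X, Ne.symm h]

/-- Modes of one sign create labels with one Boolean and annihilate labels with the other, so no
contraction can occur between them. -/
theorem psi_psi_same (s : Bool) (p q : Fin l) (m n : ℤ) :
    (Mode.psi s p m).op * (Mode.psi s q n).op = -((Mode.psi s q n).op * (Mode.psi s p m).op) := by
  rw [eq_neg_iff_add_eq_zero]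
  cases s <;> simp only [Mode.op] <;> split_ifs
  all_goals first
    | rw [fermAn_fermAn]
    | rw [fermCr_fermCr]
    | rw [fermAn_fermCr_of_ne (by simp)]
    | (rw [add_comm, fermAn_fermCr_of_ne (by simp)])

theorem gam_gam_same (s : Bool) (p q : Fin l) (m n : ℤ) :
    (Mode.gam s p m).op * (Mode.gam s q n).op = (Mode.gam s q n).op * (Mode.gam s p m).op := by
  rw [← sub_eq_zero]
  cases s <;> simp only [Mode.op] <;> split_ifs
  all_goals try simp only [mul_neg, neg_mul, neg_neg, sub_neg_eq_add, neg_add_eq_sub]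
  all_goals first
    | rw [bosAn_bosAn]
    | rw [bosCr_bosCr]
    | rw [bosAn_bosCr_of_ne (by simp)]
    | (rw [← neg_eq_zero, neg_sub, bosAn_bosCr_of_ne (by simp)])

theorem psi_gam (s t : Bool) (p q : Fin l) (m n : ℤ) :
    (Mode.psi s p m).op * (Mode.gam t q n).op = (Mode.gam t q n).op * (Mode.psi s p m).op := by
  cases s <;> cases t <;> simp only [Mode.op] <;> split_ifs <;>
    simp only [mul_neg, neg_mul, fermAn, fermCr, bosAn, bosCr, tensMap_comm]

/-- The super-bracket of two modes. -/
def Mode.pair : Mode l → Mode l → ℂ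
  | .psi s p m, .psi t q n => if s ≠ t ∧ p = q ∧ m + n = 0 then 1 else 0
  | .gam true p m, .gam false q n => if p = q ∧ m + n + 1 = 0 then 1 else 0
  | .gam false p m, .gam true q n => if p = q ∧ m + n + 1 = 0 then -1 else 0
  | _, _ => 0

/-- All relations of the fermions and bosons in one formula; from here on the two kinds are told
apart only by signs. -/
theorem Mode.op_mul_op (u v : Mode l) :
    u.op * v.op = koszul u.parity v.parity • (v.op * u.op) + u.pair v • 1 := by
  rcases u with ⟨s, p, m⟩ | ⟨s, p, m⟩ <;> rcases v with ⟨t, q, n⟩ | ⟨t, q, n⟩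
  · have key := psi_rel p q m n
    have key' := psi_rel q p n m
    have hs := psi_psi_same s p q m n
    cases s <;> cases t <;> simp [Mode.parity, Mode.pair, koszul] at hs ⊢
    · exact hs
    · rw [← eq_sub_iff_add_eq'] at key'
      rw [key', sub_eq_neg_add]
      congr 1
      simp only [eq_comm (a := q), add_comm n]
    · rw [← eq_sub_iff_add_eq] at key
      rw [key, sub_eq_neg_add]
    · exact hs
  · have := psi_gam s t p q m n
    cases s <;> cases t <;> simpa [Mode.parity, Mode.pair, koszul] using this
  · have := psi_gam t s q p n m
    cases s <;> cases t <;> simpa [Mode.parity, Mode.pair, koszul] using this.symm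
  · have key := gam_rel p q m n
    have key' := gam_rel q p n m
    have hs := gam_gam_same s p q m n
    cases s <;> cases t <;> simp [Mode.parity, Mode.pair, koszul] at hs ⊢
    · exact hs
    · rw [sub_eq_iff_eq_add'] at key'
      rw [key', add_assoc]
      simp only [eq_comm (a := q), add_comm n]
      split_ifs <;> simp
    · rw [sub_eq_iff_eq_add'] at key
      rw [key]
    · exact hs

theorem koszul_comm (a b : Fin 2) : koszul a b = koszul b a := by
  simp [koszul, mul_comm]

theorem koszul_mul_self (a b : Fin 2) : koszul a b * koszul a b = 1 := by
  rw [koszul, ← mul_pow]; simp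

/-- A nonzero pairing forces the mode numbers to add up to `0` (to `-1` for bosons, because of the
half-integral shift), and then exactly one of the two modes annihilates. -/
theorem Mode.pair_eq_zero {u v : Mode l} (h : u.ann = v.ann) : u.pair v = 0 := by
  rcases u with ⟨_ | _, p, m⟩ | ⟨_ | _, p, m⟩ <;> rcases v with ⟨_ | _, q, n⟩ | ⟨_ | _, q, n⟩ <;>
    simp [Mode.ann, Mode.pair] at h ⊢ <;> omega

/-- Normal ordering is super-commutative. -/
theorem nord_comm (u v : Mode l) : nord u v = koszul u.parity v.parity • nord v u := by
  have h := Mode.op_mul_op u v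
  unfold nord
  cases hu : u.ann <;> cases hv : v.ann <;>
    simp [koszul_comm v.parity, smul_smul, koszul_mul_self]
  all_goals
    rw [Mode.pair_eq_zero (hu.trans hv.symm)] at h
    simpa using h

/-- Wick's formula for two factors: reordering costs one scalar, the contraction. -/
theorem nord_eq (u v : Mode l) :
    nord u v = u.op * v.op - (if u.ann && !v.ann then u.pair v else 0) • 1 := by
  rw [Mode.op_mul_op u v]
  unfold nord
  split_ifs
  · simp
  · rw [Mode.op_mul_op u v]; simp

/-! ### Local finiteness -/

/-- The number of a mode: `ψ_m ↦ m`, `γ_{m+1/2} ↦ m`. -/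
def Mode.num : Mode l → ℤ
  | .psi _ _ m => m
  | .gam _ _ m => m

/-- An element of the exterior algebra involves finitely many generators, and contraction against
any other one gives zero. -/
theorem exists_contract_eq_zero (x : ExteriorAlgebra ℂ (CIdx l →₀ ℂ)) :
    ∃ N : ℕ, ∀ c : CIdx l, N ≤ c.2.2 →
      CliffordAlgebra.contractLeft (Q := (0 : QuadraticForm ℂ (CIdx l →₀ ℂ)))
        (Finsupp.lapply c) x = 0 := by
  induction x using CliffordAlgebra.left_induction with
  | algebraMap r => exact ⟨0, fun c _ => CliffordAlgebra.contractLeft_algebraMap _ _ r⟩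
  | add x y hx hy =>
    obtain ⟨M, hM⟩ := hx
    obtain ⟨N, hN⟩ := hy
    exact ⟨max M N, fun c hc => by
      rw [map_add, hM c (le_trans (le_max_left _ _) hc), hN c (le_trans (le_max_right _ _) hc),
        add_zero]⟩
  | ι_mul x v hx =>
    obtain ⟨M, hM⟩ := hx
    refine ⟨max M (v.support.sup (fun c => c.2.2) + 1), fun c hc => ?_⟩
    rw [CliffordAlgebra.contractLeft_ι_mul, hM c (le_trans (le_max_left _ _) hc)]
    have hv : v c = 0 := by
      by_contra hne
      have := Finset.le_sup (f := fun c : CIdx l => c.2.2) (Finsupp.mem_support_iff.2 hne)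
      have := le_trans (le_max_right _ _) hc
      omega
    simp [hv]

theorem exists_pderiv_eq_zero (y : MvPolynomial (CIdx l) ℂ) :
    ∃ N : ℕ, ∀ c : CIdx l, N ≤ c.2.2 → MvPolynomial.pderiv c y = 0 := by
  refine ⟨y.vars.sup (fun c => c.2.2) + 1, fun c hc =>
    MvPolynomial.pderiv_eq_zero_of_notMem_vars fun h => ?_⟩
  have := Finset.le_sup (f := fun c : CIdx l => c.2.2) h
  omega

theorem exists_an_eq_zero (v : Fock l) :
    ∃ N : ℕ, ∀ c : CIdx l, N ≤ c.2.2 → fermAn c v = 0 ∧ bosAn c v = 0 := by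
  induction v using TensorProduct.induction_on with
  | zero => exact ⟨0, fun c _ => ⟨map_zero _, map_zero _⟩⟩
  | tmul x y =>
    obtain ⟨M, hM⟩ := exists_contract_eq_zero x
    obtain ⟨N, hN⟩ := exists_pderiv_eq_zero y
    refine ⟨max M N, fun c hc => ⟨?_, ?_⟩⟩
    · refine (tensMap_tens _ _ x y).trans ?_
      rw [hM c (le_trans (le_max_left _ _) hc)]
      exact TensorProduct.zero_tmul _ _
    · refine (tensMap_tens _ _ x y).trans ?_
      have := hN c (le_trans (le_max_right _ _) hc)
      simp only [Derivation.coeFn_coe, this]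
      exact TensorProduct.tmul_zero _ _
  | add x y hx hy =>
    obtain ⟨M, hM⟩ := hx
    obtain ⟨N, hN⟩ := hy
    refine ⟨max M N, fun c hc => ?_⟩
    have h1 := hM c (le_trans (le_max_left _ _) hc)
    have h2 := hN c (le_trans (le_max_right _ _) hc)
    have e1 : fermAn c (x + y) = fermAn c x + fermAn c y := map_add (fermAn c) _ _
    have e2 : bosAn c (x + y) = bosAn c x + bosAn c y := map_add (bosAn c) _ _
    exact ⟨e1.trans (by rw [h1.1, h2.1, add_zero]), e2.trans (by rw [h1.2, h2.2, add_zero])⟩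

/-- The source of local finiteness for the matrix sums and for the normally ordered products. -/
theorem exists_op_eq_zero (v : Fock l) :
    ∃ N : ℤ, 1 ≤ N ∧ ∀ u : Mode l, N ≤ u.num → u.op v = 0 := by
  obtain ⟨N, hN⟩ := exists_an_eq_zero v
  -- The extra `1` absorbs the shift of `ψ^-_m`, which contracts against the label `m - 1`, and
  -- ensures that the bound is at least `1`.
  refine ⟨N + 1, by omega, fun u hu => ?_⟩
  rcases u with ⟨_ | _, p, m⟩ | ⟨_ | _, p, m⟩ <;> simp only [Mode.num] at hu <;>
    simp only [Mode.op]
  · rw [if_pos (by omega)]; exact (hN _ (by simp only; omega)).1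
  · rw [if_pos (by omega)]; exact (hN _ (by simp only; omega)).1
  · rw [if_pos (by omega), LinearMap.neg_apply, (hN _ (by simp only; omega)).2, neg_zero]
  · rw [if_pos (by omega)]; exact (hN _ (by simp only; omega)).2

theorem Mode.ann_of_one_le {u : Mode l} (h : 1 ≤ u.num) : u.ann = true := by
  rcases u with ⟨_ | _, p, m⟩ | ⟨_ | _, p, m⟩ <;> simp [Mode.ann, Mode.num] at h ⊢ <;> omega

theorem Mode.ann_of_neg {u : Mode l} (h : u.num < 0) : u.ann = false := by
  rcases u with ⟨_ | _, p, m⟩ | ⟨_ | _, p, m⟩ <;> simp [Mode.ann, Mode.num] at h ⊢ <;> omega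

theorem nord_apply_eq_zero_right {v : Fock l} {N : ℤ} (h1 : 1 ≤ N)
    (hN : ∀ u : Mode l, N ≤ u.num → u.op v = 0) (u w : Mode l) (hw : N ≤ w.num) :
    nord u w v = 0 := by
  rw [nord, Mode.ann_of_one_le (h1.trans hw)]
  simp [hN w hw]

/-- A left annihilation mode acts first only if the other mode creates, which `w.num < 0`
guarantees. A right annihilation mode is never moved, so the previous lemma needs no such condition.
-/
theorem nord_apply_eq_zero_left {v : Fock l} {N : ℤ} (h1 : 1 ≤ N)
    (hN : ∀ u : Mode l, N ≤ u.num → u.op v = 0) (u w : Mode l) (hu : N ≤ u.num)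
    (hw : w.num < 0) : nord u w v = 0 := by
  rw [nord, Mode.ann_of_one_le (h1.trans hu), Mode.ann_of_neg hw]
  simp [hN u hu]

/-- Every field that arises from the generating ones has the number of its modes bounded around
the opposite of the exponent. -/
theorem IsFree.exists_bound {a : FField l} (h : IsFree a) :
    ∃ K : ℤ, ∀ i, ∀ u ∈ (a i).support, |u.num + i| ≤ K := by
  have hs : ∀ (f : ℤ → Mode l), (∀ i, |(f i).num + i| ≤ 1) →
      ∃ K : ℤ, ∀ i, ∀ u ∈ (Finsupp.single (f i) (1 : ℂ)).support, |u.num + i| ≤ K :=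
    fun f hf => ⟨1, fun i u hu => by
      have := Finsupp.support_single_subset hu
      rw [Finset.mem_singleton] at this
      exact this ▸ hf i⟩
  induction h with
  | psiP p => exact hs _ fun i => by simp only [Mode.num]; rw [abs_le]; omega
  | psiM p => exact hs _ fun i => by simp only [Mode.num]; rw [abs_le]; omega
  | gamP p => exact hs _ fun i => by simp only [Mode.num]; rw [abs_le]; omega
  | gamM p => exact hs _ fun i => by simp only [Mode.num]; rw [abs_le]; omega
  | dz _ ih =>
    obtain ⟨K, hK⟩ := ih
    refine ⟨K + 1, fun i u hu => ?_⟩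
    have := hK _ u (Finsupp.support_smul hu)
    rw [abs_le] at this ⊢
    omega
  | zmul _ ih =>
    obtain ⟨K, hK⟩ := ih
    refine ⟨K + 1, fun i u hu => ?_⟩
    have := hK _ u hu
    rw [abs_le] at this ⊢
    omega
  | zneg _ ih =>
    obtain ⟨K, hK⟩ := ih
    exact ⟨K, fun i u hu => hK _ u (Finsupp.support_smul hu)⟩

/-- The mode numbers in the `i`-th term are close to `-i` and `i - m`. For `i` large the right mode
is a deep annihilator; for `i` very negative the left one is, and the right one creates. -/
theorem locFin_nordTerms {a b : FField l} (ha : IsFree a) (hb : IsFree b) (m : ℤ) :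
    LocFin (nordTerms a b m) := fun v => by
  obtain ⟨K, hK⟩ := ha.exists_bound
  obtain ⟨L, hL⟩ := hb.exists_bound
  obtain ⟨N, h1, hN⟩ := exists_op_eq_zero v
  refine (Set.finite_Icc (-(N + |K| + |L| + |m|)) (N + |K| + |L| + |m|)).subset fun i hi => ?_
  by_contra hn
  refine hi ?_
  simp only [nordTerms, nordLin, Finsupp.sum, LinearMap.sum_apply, LinearMap.smul_apply]
  refine Finset.sum_eq_zero fun u hu => Finset.sum_eq_zero fun w hw => ?_
  have e1 := abs_le.1 (hK i u hu)
  have e2 := abs_le.1 (hL (m - i) w hw)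
  have := le_abs_self K
  have := le_abs_self L
  have := le_abs_self m
  have := neg_abs_le m
  have := abs_nonneg K
  have := abs_nonneg L
  rw [Set.mem_Icc, not_and_or] at hn
  have : nord u w v = 0 := by
    rcases hn with hn | hn
    · exact nord_apply_eq_zero_left h1 hN u w (by omega) (by omega)
    · exact nord_apply_eq_zero_right h1 hN u w (by omega)
  rw [this, smul_zero]

theorem rowMode_num (p : Fin l) (x : Fin 2 × ℤ) : (rowMode p x).num = -x.2 := by
  unfold rowMode; split_ifs <;> rfl

theorem colMode_num (p : Fin l) (y : Fin 2 × ℤ) :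
    y.2 - 1 ≤ (colMode p y).num ∧ (colMode p y).num ≤ y.2 := by
  unfold colMode; split_ifs <;> simp [Mode.num]

/-- Within the band the two indices go to infinity together: at one end the column mode is a deep
annihilator, at the other the row mode is while the column mode creates. -/
theorem locFin_matrix (A : GlInf) (p : Fin l) :
    LocFin fun xy : (Fin 2 × ℤ) × (Fin 2 × ℤ) =>
      A.1 xy.1 xy.2 • nord (rowMode p xy.1) (colMode p xy.2) := fun v => by
  obtain ⟨K, hK⟩ := A.2
  obtain ⟨N, h1, hN⟩ := exists_op_eq_zero v
  have hfin := (Set.finite_univ (α := Fin 2)).prod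
    (Set.finite_Icc (-(N + |K| + 1)) (N + |K| + 1))
  refine (hfin.prod hfin).subset ?_
  rintro ⟨⟨a, i⟩, ⟨b, j⟩⟩ hij
  by_contra hn
  refine hij ?_
  by_cases hd : K < |i - j|
  · simp [hK (a, i) (b, j) hd]
  · rw [not_lt, abs_le] at hd
    have e1 := rowMode_num p (a, i)
    have e2 := colMode_num p (b, j)
    have := le_abs_self K
    have := abs_nonneg K
    simp only [Set.mem_prod, Set.mem_univ, true_and, Set.mem_Icc] at hn e1 e2
    have : nord (rowMode p (a, i)) (colMode p (b, j)) v = 0 := by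
      by_cases hj : N + 1 ≤ j
      · exact nord_apply_eq_zero_right h1 hN _ _ (by omega)
      · exact nord_apply_eq_zero_left h1 hN _ _ (by omega) (by omega)
    simp [this]

theorem locFin_glTerms (A : GlInf) : LocFin (glTerms l A) := by
  have h := (LocFin.sum Finset.univ fun p => locFin_matrix (l := l) A p).smul
    fun xy => if xy.1.1 = 0 then (1 : ℂ) else -1
  convert h using 2 with xy
  rw [glTerms, elemOp, ← Finset.smul_sum, smul_comm]

/-! ### Parity -/

theorem parityOp_fermCr (c : CIdx l) : parityOp l * fermCr c = -(fermCr c * parityOp l) := by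
  rw [eq_neg_iff_add_eq_zero]
  simp only [parityOp, fermCr, tensMap_mul, ← tensMap_add_left, mul_one]
  rw [← tensMap_zero_left 1]
  congr 1
  refine LinearMap.ext fun x => ?_
  simp only [LinearMap.add_apply, Module.End.mul_apply, LinearMap.mulLeft_apply,
    AlgHom.toLinearMap_apply]
  erw [map_mul, CliffordAlgebra.involute_ι]
  simp [ExteriorAlgebra.ι]

theorem involute_contractLeft (d : Module.Dual ℂ (CIdx l →₀ ℂ))
    (x : CliffordAlgebra (0 : QuadraticForm ℂ (CIdx l →₀ ℂ))) :
    CliffordAlgebra.involute (CliffordAlgebra.contractLeft d x) =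
      -CliffordAlgebra.contractLeft d (CliffordAlgebra.involute x) := by
  induction x using CliffordAlgebra.left_induction with
  | algebraMap r => simp [CliffordAlgebra.contractLeft_algebraMap]
  | add x y hx hy => simp only [map_add, hx, hy, neg_add]
  | ι_mul x v hx =>
    rw [CliffordAlgebra.contractLeft_ι_mul, map_sub, map_mul, map_mul, hx,
      CliffordAlgebra.involute_ι, neg_mul, neg_mul, map_neg, CliffordAlgebra.contractLeft_ι_mul,
      map_smul]
    simp

theorem parityOp_fermAn (c : CIdx l) : parityOp l * fermAn c = -(fermAn c * parityOp l) := by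
  rw [eq_neg_iff_add_eq_zero]
  simp only [parityOp, fermAn, tensMap_mul, ← tensMap_add_left, mul_one]
  rw [← tensMap_zero_left 1]
  congr 1
  refine LinearMap.ext fun x => ?_
  simp only [LinearMap.add_apply, Module.End.mul_apply, AlgHom.toLinearMap_apply]
  rw [involute_contractLeft]
  simp

theorem parityOp_op (u : Mode l) :
    parityOp l * u.op = (-1 : ℂ) ^ u.parity.val • (u.op * parityOp l) := by
  rcases u with ⟨_ | _, p, m⟩ | ⟨_ | _, p, m⟩ <;> simp only [Mode.op, Mode.parity] <;> split_ifs <;>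
    simp [parityOp_fermAn, parityOp_fermCr] <;>
    simp [parityOp, bosAn, bosCr, tensMap_comm]

theorem parityOp_op_mul_op (u v : Mode l) :
    parityOp l * (u.op * v.op) =
      ((-1 : ℂ) ^ u.parity.val * (-1) ^ v.parity.val) • (u.op * v.op * parityOp l) := by
  rw [← mul_assoc, parityOp_op, smul_mul_assoc, mul_assoc, parityOp_op, mul_smul_comm, smul_smul,
    mul_assoc]

theorem parityOp_nord (u v : Mode l) :
    parityOp l * nord u v =
      ((-1 : ℂ) ^ u.parity.val * (-1) ^ v.parity.val) • (nord u v * parityOp l) := by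
  unfold nord
  split_ifs
  · rw [mul_smul_comm, parityOp_op_mul_op, smul_comm, mul_comm ((-1 : ℂ) ^ _), smul_mul_assoc]
  · exact parityOp_op_mul_op u v

end Modes

/-! ### Brackets of the elementary matrices -/

section Elementary

variable {l : ℕ}

/-- The sign `+` for integral indices and `-` for half-integral ones. -/
def isgn (a : Fin 2) : ℂ := if a = 0 then 1 else -1

theorem isgn_mul_self (a : Fin 2) : isgn a * isgn a = 1 := by
  unfold isgn; split_ifs <;> simp

theorem rowMode_ann (p : Fin l) (x : Fin 2 × ℤ) : (rowMode p x).ann = decide (x.2 ≤ 0) := by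
  unfold rowMode; split_ifs <;> simp [Mode.ann]

theorem colMode_ann (p : Fin l) (x : Fin 2 × ℤ) : (colMode p x).ann = decide (1 ≤ x.2) := by
  unfold colMode; split_ifs <;> simp [Mode.ann]

/-- The parity of the modes that belong to an index. -/
def ipar (a : Fin 2) : Fin 2 := if a = 0 then 1 else 0

theorem rowMode_parity (p : Fin l) (x : Fin 2 × ℤ) : (rowMode p x).parity = ipar x.1 := by
  unfold rowMode ipar; split_ifs <;> rfl

theorem colMode_parity (p : Fin l) (x : Fin 2 × ℤ) : (colMode p x).parity = ipar x.1 := by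
  unfold colMode ipar; split_ifs <;> rfl

theorem pair_row_col (p q : Fin l) (x y : Fin 2 × ℤ) :
    (rowMode p x).pair (colMode q y) = if p = q ∧ x = y then 1 else 0 := by
  obtain ⟨a, i⟩ := x
  obtain ⟨b, j⟩ := y
  fin_cases a <;> fin_cases b <;> simp [rowMode, colMode, Mode.pair] <;> congr 1 <;>
    simp only [eq_iff_iff] <;> omega

/-- The sign appears because the bosonic commutator is antisymmetric, whereas the fermionic
anticommutator is symmetric. It explains the minus sign in `E_{rs}` and `E_{rj}`. -/
theorem pair_col_row (p q : Fin l) (x y : Fin 2 × ℤ) :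
    (colMode p x).pair (rowMode q y) = if p = q ∧ x = y then isgn x.1 else 0 := by
  obtain ⟨a, i⟩ := x
  obtain ⟨b, j⟩ := y
  fin_cases a <;> fin_cases b <;> simp [rowMode, colMode, Mode.pair, isgn] <;> congr 1 <;>
    simp only [eq_iff_iff] <;> omega

theorem row_mul_row (p q : Fin l) (x y : Fin 2 × ℤ) :
    (rowMode p x).op * (rowMode q y).op =
      koszul (ipar x.1) (ipar y.1) • ((rowMode q y).op * (rowMode p x).op) := by
  have h := Mode.op_mul_op (rowMode p x) (rowMode q y)
  have h0 : (rowMode p x).pair (rowMode q y) = 0 := by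
    obtain ⟨a, i⟩ := x
    obtain ⟨b, j⟩ := y
    fin_cases a <;> fin_cases b <;> simp [rowMode, Mode.pair]
  rw [h0, zero_smul, add_zero, rowMode_parity, rowMode_parity] at h
  exact h

theorem col_mul_col (p q : Fin l) (x y : Fin 2 × ℤ) :
    (colMode p x).op * (colMode q y).op =
      koszul (ipar x.1) (ipar y.1) • ((colMode q y).op * (colMode p x).op) := by
  have h := Mode.op_mul_op (colMode p x) (colMode q y)
  have h0 : (colMode p x).pair (colMode q y) = 0 := by
    obtain ⟨a, i⟩ := x
    obtain ⟨b, j⟩ := y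
    fin_cases a <;> fin_cases b <;> simp [colMode, Mode.pair]
  rw [h0, zero_smul, add_zero, colMode_parity, colMode_parity] at h
  exact h

theorem row_mul_col (p q : Fin l) (x y : Fin 2 × ℤ) :
    (rowMode p x).op * (colMode q y).op =
      koszul (ipar x.1) (ipar y.1) • ((colMode q y).op * (rowMode p x).op)
        + (if p = q ∧ x = y then (1 : ℂ) else 0) • 1 := by
  rw [Mode.op_mul_op, rowMode_parity, colMode_parity, pair_row_col]

theorem col_mul_row (p q : Fin l) (x y : Fin 2 × ℤ) :
    (colMode p x).op * (rowMode q y).op =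
      koszul (ipar x.1) (ipar y.1) • ((rowMode q y).op * (colMode p x).op)
        + (if p = q ∧ x = y then isgn x.1 else 0) • 1 := by
  rw [Mode.op_mul_op, rowMode_parity, colMode_parity, pair_col_row]

/-- Since `ipar a = a + 1`, a row mode times a column mode has parity `a + b`; exchanging two such
products collects the four signs on the left. -/
theorem koszul_ipar (a b c d : Fin 2) :
    koszul (ipar b) (ipar c) * koszul (ipar a) (ipar c) * koszul (ipar b) (ipar d)
      * koszul (ipar a) (ipar d) = koszul (a + b) (c + d) := by
  fin_cases a <;> fin_cases b <;> fin_cases c <;> fin_cases d <;> simp [ipar, koszul]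

theorem koszul_ipar_self (a b c : Fin 2) :
    koszul (ipar b) (ipar c) * koszul (ipar a) (ipar c) * koszul (ipar b) (ipar a)
      = -(koszul (a + b) (c + a) * isgn a) := by
  fin_cases a <;> fin_cases b <;> fin_cases c <;> simp [ipar, koszul, isgn]

/-- The super-commutator of two products of modes. -/
theorem row_col_mul_row_col (p q : Fin l) (x y z w : Fin 2 × ℤ) :
    (rowMode p x).op * (colMode p y).op * ((rowMode q z).op * (colMode q w).op) =
      koszul (x.1 + y.1) (z.1 + w.1) •
          ((rowMode q z).op * (colMode q w).op * ((rowMode p x).op * (colMode p y).op))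
        + (if p = q ∧ y = z then isgn y.1 else 0) • ((rowMode p x).op * (colMode q w).op)
        - (if p = q ∧ x = w then koszul (x.1 + y.1) (z.1 + w.1) * isgn x.1 else 0) •
          ((rowMode q z).op * (colMode p y).op) := by
  have h1 := col_mul_row p q y z
  have h2 := row_mul_row p q x z
  have h3 := col_mul_col p q y w
  have h4 := row_mul_col p q x w
  -- The second contraction occurs after three exchanges, so its sign is the product of their Koszul
  -- signs.
  have e : (if p = q ∧ x = w then koszul (x.1 + y.1) (z.1 + w.1) * isgn x.1 else 0)
      = -(koszul (ipar y.1) (ipar z.1) * koszul (ipar x.1) (ipar z.1)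
        * koszul (ipar y.1) (ipar w.1)) * (if p = q ∧ x = w then (1 : ℂ) else 0) := by
    split_ifs with h
    · obtain ⟨-, rfl⟩ := h
      rw [koszul_ipar_self]; ring
    · simp
  rw [e, ← koszul_ipar]
  generalize (rowMode p x).op = Rx at *
  generalize (rowMode q z).op = Rz at *
  generalize (colMode p y).op = Cy at *
  generalize (colMode q w).op = Cw at *
  -- Only the exchanges of `Cy` with `Rz` and of `Rx` with `Cw` leave a contraction; two row modes
  -- or two column modes supercommute.
  calc Rx * Cy * (Rz * Cw) = Rx * (Cy * Rz) * Cw := by simp only [mul_assoc]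
    _ = koszul (ipar y.1) (ipar z.1) • ((Rx * Rz) * (Cy * Cw))
        + (if p = q ∧ y = z then isgn y.1 else 0) • (Rx * Cw) := by
      rw [h1]
      simp only [mul_add, add_mul, mul_smul_comm, smul_mul_assoc, mul_assoc, mul_one]
    _ = (koszul (ipar y.1) (ipar z.1) * koszul (ipar x.1) (ipar z.1)
        * koszul (ipar y.1) (ipar w.1)) • (Rz * (Rx * Cw) * Cy)
        + (if p = q ∧ y = z then isgn y.1 else 0) • (Rx * Cw) := by
      rw [h2, h3]
      simp only [mul_smul_comm, smul_mul_assoc, mul_assoc, smul_smul]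
      congr 2; ring
    _ = _ := by
      rw [h4]
      simp only [mul_add, add_mul, mul_smul_comm, smul_mul_assoc, mul_assoc, mul_one,
        smul_add, smul_smul, neg_mul, neg_smul, sub_neg_eq_add]
      abel

/-- The action of the elementary matrices without normal ordering. -/
def rawOp (l : ℕ) (x y : Fin 2 × ℤ) : Module.End ℂ (Fock l) :=
  isgn x.1 • ∑ p : Fin l, (rowMode p x).op * (colMode p y).op

/-- These are the matrix superalgebra relations with no central term. Distinct copies do not
contract, so the contraction terms collapse to `p = q`, and the factor `isgn` absorbs the sign of
`pair_col_row`. -/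
theorem rawOp_mul (x y z w : Fin 2 × ℤ) :
    rawOp l x y * rawOp l z w =
      koszul (x.1 + y.1) (z.1 + w.1) • (rawOp l z w * rawOp l x y)
        + (if y = z then (1 : ℂ) else 0) • rawOp l x w
        - (if x = w then koszul (x.1 + y.1) (z.1 + w.1) else 0) • rawOp l z y := by
  have hs : ∀ (P : Prop) [Decidable P] (c : ℂ) (f : Fin l → Fin l → Module.End ℂ (Fock l)),
      ∑ p, ∑ q, (if p = q ∧ P then c else 0) • f p q = (if P then c else 0) • ∑ p, f p p := by
    intro P _ c f
    rw [Finset.smul_sum]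
    refine Finset.sum_congr rfl fun p _ => ?_
    rw [Finset.sum_eq_single p (fun q _ hq => by simp [hq.symm]) (by simp)]
    simp
  have key : (∑ p : Fin l, (rowMode p x).op * (colMode p y).op) *
      (∑ q : Fin l, (rowMode q z).op * (colMode q w).op) =
      koszul (x.1 + y.1) (z.1 + w.1) • ((∑ q : Fin l, (rowMode q z).op * (colMode q w).op) *
        (∑ p : Fin l, (rowMode p x).op * (colMode p y).op))
      + (if y = z then isgn y.1 else 0) • ∑ p : Fin l, (rowMode p x).op * (colMode p w).op
      - (if x = w then koszul (x.1 + y.1) (z.1 + w.1) * isgn x.1 else 0) •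
        ∑ p : Fin l, (rowMode p z).op * (colMode p y).op := by
    rw [Finset.sum_mul_sum, Finset.sum_mul_sum, Finset.sum_congr rfl fun p _ =>
      Finset.sum_congr rfl fun q _ => row_col_mul_row_col p q x y z w]
    simp only [Finset.sum_add_distrib, Finset.sum_sub_distrib, hs]
    rw [Finset.sum_comm (s := Finset.univ)]
    simp only [Finset.smul_sum]
  simp only [rawOp, smul_mul_smul_comm]
  rw [key, smul_sub, smul_add]
  congr 1
  · congr 1
    · rw [smul_comm, mul_comm]
    · rw [smul_smul, smul_smul]
      congr 1
      split_ifs with h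
      · subst h; rw [mul_assoc, isgn_mul_self, one_mul, mul_one]
      · simp
  · rw [smul_smul, smul_smul]
    congr 1
    split_ifs with h
    · linear_combination (koszul (x.1 + y.1) (z.1 + w.1) * isgn z.1) * isgn_mul_self x.1
    · simp

/-- The vacuum expectation value of `rawOp`. -/
def vacVal (l : ℕ) (x y : Fin 2 × ℤ) : ℂ := if x = y ∧ x.2 ≤ 0 then isgn x.1 * l else 0

theorem elemOp_eq (x y : Fin 2 × ℤ) : elemOp l x y = rawOp l x y - vacVal l x y • 1 := by
  have h : ∀ p : Fin l, nord (rowMode p x) (colMode p y) = (rowMode p x).op * (colMode p y).op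
      - (if x = y ∧ x.2 ≤ 0 then (1 : ℂ) else 0) • 1 := fun p => by
    rw [nord_eq, rowMode_ann, colMode_ann, pair_row_col]
    congr 2
    by_cases hxy : x = y
    · subst hxy
      by_cases hx : x.2 ≤ 0
      · simp [hx, show x.2 < 1 by omega]
      · simp [hx]
    · simp [hxy]
  rw [elemOp, rawOp, ← isgn, Finset.sum_congr rfl fun p _ => h p, Finset.sum_sub_distrib, smul_sub]
  congr 1
  rw [Finset.sum_const, Finset.card_univ, Fintype.card_fin, ← Nat.cast_smul_eq_nsmul ℂ, smul_smul,
    smul_smul, vacVal]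
  congr 1
  split_ifs <;> simp

/-- The expectation value vanishes on odd elements, so the Koszul sign is invisible to it. This
makes the scalar corrections cancel in the super-commutator. -/
theorem vacVal_koszul (x y : Fin 2 × ℤ) (c : Fin 2) :
    vacVal l x y * koszul (x.1 + y.1) c = vacVal l x y := by
  unfold vacVal
  split_ifs with h
  · obtain ⟨rfl, -⟩ := h
    rw [show x.1 + x.1 = 0 by generalize x.1 = a; fin_cases a <;> rfl]
    simp [koszul]
  · simp

/-- The super-bracket of two elementary matrices in the Fock space. -/
theorem elemOp_bracket (x y z w : Fin 2 × ℤ) :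
    elemOp l x y * elemOp l z w
        - koszul (x.1 + y.1) (z.1 + w.1) • (elemOp l z w * elemOp l x y) =
      (if y = z then (1 : ℂ) else 0) • elemOp l x w
        - (if x = w then koszul (x.1 + y.1) (z.1 + w.1) else 0) • elemOp l z y
        + (if y = z ∧ x = w then isgn x.1 *
          ((if x.2 ≤ 0 then 1 else 0) - (if y.2 ≤ 0 then 1 else 0)) * l else 0) • 1 := by
  have h1 := vacVal_koszul (l := l) x y (z.1 + w.1)
  have h2 := vacVal_koszul (l := l) z w (x.1 + y.1)
  rw [koszul_comm] at h2
  -- The central term is `vacVal` applied to the bracket of the two elementary matrices.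
  have h3 : (if y = z ∧ x = w then isgn x.1 *
          ((if x.2 ≤ 0 then 1 else 0) - (if y.2 ≤ 0 then 1 else 0)) * l else 0) =
      (if y = z then (1 : ℂ) else 0) * vacVal l x w
        - (if x = w then koszul (x.1 + y.1) (z.1 + w.1) else 0) * vacVal l z y := by
    unfold vacVal
    by_cases hy : y = z <;> by_cases hx : x = w
    · subst hy hx
      have : koszul (x.1 + y.1) (y.1 + x.1) * isgn y.1 = isgn x.1 := by
        generalize x.1 = a
        generalize y.1 = b
        fin_cases a <;> fin_cases b <;> simp [koszul, isgn]
      simp only [true_and, if_true, one_mul]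
      split_ifs <;> first
        | ring1
        | linear_combination (l : ℂ) * this
    · simp [hy, hx]
    · subst hx
      simp [hy, Ne.symm hy]
    · simp [hx, hy]
  rw [h3]
  have hr := rawOp_mul (l := l) x y z w
  generalize koszul (x.1 + y.1) (z.1 + w.1) = k at *
  simp only [elemOp_eq, mul_sub, sub_mul, hr, mul_smul_comm, smul_mul_assoc, mul_one,
    one_mul, smul_sub, smul_smul, ← mul_assoc]
  rw [mul_comm k, mul_comm k, h1, h2]
  module

end Elementary

/-! ### Bilinearity -/

theorem mono_smul (k : ℤ) (a b : Fin 2) (c : ℂ) (f : ℂ[X]) :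
    mono k a b (c • f) = c • mono k a b f := by
  simp [mono, ← Matrix.smul_single]

theorem SD.induction {P : SD → Prop} (A : SD) (zero : P 0) (add : ∀ A B, P A → P B → P (A + B))
    (mono : ∀ k a b f, P (mono k a b f)) : P A := by
  induction A using Finsupp.induction_linear with
  | zero => exact zero
  | add A B hA hB => exact add A B hA hB
  | single k F =>
    rw [Matrix.matrix_eq_sum_single F]
    have hs : ∀ (s : Finset (Fin 2)) (G : Fin 2 → Matrix (Fin 2) (Fin 2) ℂ[X]),
        (∀ a, P (Finsupp.single k (G a))) → P (Finsupp.single k (∑ a ∈ s, G a)) := by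
      intro s G h
      induction s using Finset.induction_on with
      | empty => simpa using zero
      | insert a s ha ih =>
        rw [Finset.sum_insert ha, Finsupp.single_add]
        exact add _ _ (h a) ih
    exact hs _ _ fun a => hs _ _ fun b => mono k a b _

theorem part_add (p : Fin 2) (A B : SD) : part p (A + B) = part p A + part p B := by
  unfold part
  refine Finsupp.sum_add_index' (fun r => ?_) fun r F G => ?_
  · rw [Finsupp.single_eq_zero]; ext a b : 2; simp
  · rw [← Finsupp.single_add]
    congr 1
    ext a b : 2
    by_cases h : a + b = p <;> simp [h]

theorem part_zero (p : Fin 2) : part p 0 = 0 := by simp [part]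

theorem part_mono (p : Fin 2) (k : ℤ) (a b : Fin 2) (f : ℂ[X]) :
    part p (mono k a b f) = if a + b = p then mono k a b f else 0 := by
  unfold part mono
  rw [Finsupp.sum_single_index (by rw [Finsupp.single_eq_zero]; ext a b : 2; simp)]
  split_ifs with h
  · congr 1
    ext i j : 2
    simp only [Matrix.of_apply, Matrix.single_apply]
    split_ifs with h1 h2 h2 <;> simp_all
  · rw [Finsupp.single_eq_zero]
    ext i j : 2
    simp only [Matrix.of_apply, Matrix.single_apply]
    split_ifs with h1 h2 <;> simp_all

theorem part_part (p q : Fin 2) (A : SD) :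
    part p (part q A) = if p = q then part q A else 0 := by
  induction A using SD.induction with
  | zero => simp [part_zero]
  | add A B hA hB => simp only [part_add, hA, hB]; split_ifs <;> simp
  | mono k a b f =>
    simp only [part_mono]
    split_ifs with h1 h2 h2
    · subst h1; simp [part_mono, h2]
    · simp only [part_mono]; rw [if_neg]; rintro rfl; exact h2 h1
    · exact part_zero _
    · exact part_zero _

theorem transl_add (s : ℤ) (f g : ℂ[X]) : transl s (f + g) = transl s f + transl s g := by
  simp [transl]

theorem shift_add (s : ℤ) (F G : Matrix (Fin 2) (Fin 2) ℂ[X]) :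
    shift s (F + G) = shift s F + shift s G := by
  ext a b : 2; simp [shift, transl_add]

theorem shift_zero (s : ℤ) : shift s 0 = 0 := by
  ext a b : 2; simp [shift, transl]

theorem mul_add_left (A A' B : SD) : mul (A + A') B = mul A B + mul A' B := by
  unfold mul
  refine Finsupp.sum_add_index' (fun r => ?_) fun r F G => ?_
  · simp [shift_zero]
  · rw [← Finsupp.sum_add]
    refine Finsupp.sum_congr fun s _ => ?_
    rw [shift_add, add_mul, Finsupp.single_add]

theorem mul_add_right (A B B' : SD) : mul A (B + B') = mul A B + mul A B' := by
  unfold mul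
  rw [← Finsupp.sum_add]
  refine Finsupp.sum_congr fun r _ => ?_
  refine Finsupp.sum_add_index' (fun s => ?_) fun s F G => ?_
  · simp
  · rw [mul_add, Finsupp.single_add]

theorem mul_zero_left (B : SD) : mul 0 B = 0 := by simp [mul]

theorem mul_zero_right (A : SD) : mul A 0 = 0 := by simp [mul]

theorem sbr_add_left (A A' B : SD) : sbr (A + A') B = sbr A B + sbr A' B := by
  simp only [sbr, part_add, mul_add_left, mul_add_right, ← Finset.sum_add_distrib]
  refine Finset.sum_congr rfl fun p _ => Finset.sum_congr rfl fun q _ => ?_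
  module

theorem sbr_add_right (A B B' : SD) : sbr A (B + B') = sbr A B + sbr A B' := by
  simp only [sbr, part_add, mul_add_left, mul_add_right, ← Finset.sum_add_distrib]
  refine Finset.sum_congr rfl fun p _ => Finset.sum_congr rfl fun q _ => ?_
  module

theorem sbr_zero_left (B : SD) : sbr 0 B = 0 := by
  simp [sbr, part_zero, mul_zero_left, mul_zero_right]

theorem sbr_zero_right (A : SD) : sbr A 0 = 0 := by
  simp [sbr, part_zero, mul_zero_left, mul_zero_right]

/-- Monomials are homogeneous, so a single pair of parities survives; this serves both the bracket
of operators and the commutator of their actions. -/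
theorem sum_part_mono {M : Type*} [AddCommGroup M] (r s : ℤ) (a b c d : Fin 2) (f g : ℂ[X])
    (T : Fin 2 → Fin 2 → SD → SD → M) (h1 : ∀ p q B, T p q 0 B = 0) (h2 : ∀ p q A, T p q A 0 = 0) :
    ∑ p, ∑ q, T p q (part p (mono r a b f)) (part q (mono s c d g)) =
      T (a + b) (c + d) (mono r a b f) (mono s c d g) := by
  rw [Finset.sum_eq_single (a + b), Finset.sum_eq_single (c + d)]
  · simp [part_mono]
  · intro q _ hq
    rw [part_mono q, if_neg hq.symm, h2]
  · simp
  · intro p _ hp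
    refine Finset.sum_eq_zero fun q _ => ?_
    rw [part_mono p, if_neg hp.symm, h1]
  · simp

theorem sbr_mono (r s : ℤ) (a b c d : Fin 2) (f g : ℂ[X]) :
    sbr (mono r a b f) (mono s c d g) = mul (mono r a b f) (mono s c d g)
      - koszul (a + b) (c + d) • mul (mono s c d g) (mono r a b f) :=
  sum_part_mono r s a b c d f g (fun p q A B => mul A B - koszul p q • mul B A)
    (by simp [mul_zero_left, mul_zero_right]) (by simp [mul_zero_left, mul_zero_right])

/-- The terms of the cocycle. -/
def cocycleTerm (r s : ℤ) (F G : Matrix (Fin 2) (Fin 2) ℂ[X]) : ℂ :=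
  if r + s = 0 then
    if 0 ≤ r then ∑ j ∈ Finset.Ico (-r) 0, strEval F G (j : ℂ) ((j + r : ℤ) : ℂ)
    else -∑ j ∈ Finset.Ico 0 (-r), strEval F G (j : ℂ) ((j + r : ℤ) : ℂ)
  else 0

theorem cocycle_eq (A B : SD) :
    cocycle A B = A.sum fun r F => B.sum fun s G => cocycleTerm r s F G := rfl

theorem strEval_add_left (F F' G : Matrix (Fin 2) (Fin 2) ℂ[X]) (x y : ℂ) :
    strEval (F + F') G x y = strEval F G x y + strEval F' G x y := by
  simp [strEval, Matrix.mul_apply]; ring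

theorem strEval_add_right (F G G' : Matrix (Fin 2) (Fin 2) ℂ[X]) (x y : ℂ) :
    strEval F (G + G') x y = strEval F G x y + strEval F G' x y := by
  simp [strEval, Matrix.mul_apply]; ring

theorem cocycleTerm_add_left (r s : ℤ) (F F' G : Matrix (Fin 2) (Fin 2) ℂ[X]) :
    cocycleTerm r s (F + F') G = cocycleTerm r s F G + cocycleTerm r s F' G := by
  unfold cocycleTerm
  split_ifs <;> simp only [strEval_add_left, Finset.sum_add_distrib, neg_add, add_zero]

theorem cocycleTerm_add_right (r s : ℤ) (F G G' : Matrix (Fin 2) (Fin 2) ℂ[X]) :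
    cocycleTerm r s F (G + G') = cocycleTerm r s F G + cocycleTerm r s F G' := by
  unfold cocycleTerm
  split_ifs <;> simp only [strEval_add_right, Finset.sum_add_distrib, neg_add, add_zero]

theorem cocycleTerm_zero_left (r s : ℤ) (G : Matrix (Fin 2) (Fin 2) ℂ[X]) :
    cocycleTerm r s 0 G = 0 := by
  simpa using cocycleTerm_add_left r s 0 0 G

theorem cocycleTerm_zero_right (r s : ℤ) (F : Matrix (Fin 2) (Fin 2) ℂ[X]) :
    cocycleTerm r s F 0 = 0 := by
  simpa using cocycleTerm_add_right r s F 0 0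

theorem cocycle_add_left (A A' B : SD) : cocycle (A + A') B = cocycle A B + cocycle A' B := by
  simp only [cocycle_eq]
  refine Finsupp.sum_add_index' (fun r => ?_) fun r F G => ?_
  · simp [cocycleTerm_zero_left]
  · rw [← Finsupp.sum_add]
    exact Finsupp.sum_congr fun s _ => cocycleTerm_add_left _ _ _ _ _

theorem cocycle_add_right (A B B' : SD) : cocycle A (B + B') = cocycle A B + cocycle A B' := by
  simp only [cocycle_eq]
  rw [← Finsupp.sum_add]
  refine Finsupp.sum_congr fun r _ => ?_
  exact Finsupp.sum_add_index' (fun s => cocycleTerm_zero_right _ _ _)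
    fun s F G => cocycleTerm_add_right _ _ _ _ _

theorem cocycle_zero_left (B : SD) : cocycle 0 B = 0 := by simp [cocycle]

theorem cocycle_zero_right (A : SD) : cocycle A 0 = 0 := by simp [cocycle]

theorem strEval_single (a b c d : Fin 2) (f g : ℂ[X]) (x y : ℂ) :
    strEval (Matrix.single a b f) (Matrix.single c d g) x y =
      if b = c ∧ a = d then isgn a * (f.eval x * g.eval y) else 0 := by
  fin_cases a <;> fin_cases b <;> fin_cases c <;> fin_cases d <;>
    simp [strEval, Matrix.mul_apply, isgn, Matrix.single_apply]

theorem cocycle_mono (r s : ℤ) (a b c d : Fin 2) (f g : ℂ[X]) :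
    cocycle (mono r a b f) (mono s c d g) =
      cocycleTerm r s (Matrix.single a b f) (Matrix.single c d g) := by
  rw [cocycle_eq, mono, mono, Finsupp.sum_single_index (by simp [cocycleTerm_zero_left]),
    Finsupp.sum_single_index (by exact cocycleTerm_zero_right _ _ _)]

/-! ### The action -/

section Action

variable (l : ℕ)

theorem glTerms_phi_add (A B : SD) :
    glTerms l (phi (A + B)) = fun xy => glTerms l (phi A) xy + glTerms l (phi B) xy := by
  funext xy
  simp [glTerms, phi, add_smul]

theorem glTerms_phi_smul (c : ℂ) (A : SD) :
    glTerms l (phi (c • A)) = fun xy => c • glTerms l (phi A) xy := by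
  funext xy
  simp [glTerms, phi, smul_smul]

/-- The action of the differential operators on the Fock space. -/
def actS : SD →ₗ[ℂ] Module.End ℂ (Fock l) where
  toFun A := locSum (glTerms l (phi A))
  map_add' A B := by
    rw [glTerms_phi_add, locSum_add (locFin_glTerms _) (locFin_glTerms _)]
  map_smul' c A := by
    rw [glTerms_phi_smul, locSum_const_smul (locFin_glTerms _)]; rfl

theorem act_eq (x : HatSD) : act l x = actS l x.1 + (x.2 * (l : ℂ)) • 1 := rfl

theorem act_toHat (A : SD) : act l (toHat A) = actS l A := by
  rw [act_eq]; simp [toHat]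

theorem phi_mono_apply (k : ℤ) (a b : Fin 2) (f : ℂ[X]) (x y : Fin 2 × ℤ) :
    (phi (mono k a b f)).1 x y =
      if x = (a, y.2 - k) ∧ y.1 = b then f.eval (-(y.2 : ℂ)) else 0 := by
  obtain ⟨x1, x2⟩ := x
  obtain ⟨y1, y2⟩ := y
  simp only [phi, mono, Finsupp.single_apply, Prod.mk.injEq]
  by_cases h : k = y2 - x2
  · rw [if_pos h, Matrix.single_apply]
    subst h
    simp only [sub_sub_cancel, and_true]
    simp only [eq_comm (a := a), eq_comm (a := b)]
    split_ifs <;> simp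
  · rw [if_neg h, if_neg (by rintro ⟨⟨-, h'⟩, -⟩; omega)]
    simp

theorem diag_injective (k : ℤ) (a b : Fin 2) :
    Function.Injective fun j : ℤ => (((a, j - k), (b, j)) : (Fin 2 × ℤ) × (Fin 2 × ℤ)) :=
  fun i j h => by simp at h; exact h

theorem locFin_diag (k : ℤ) (a b : Fin 2) (f : ℂ[X]) :
    LocFin fun j : ℤ => f.eval (-(j : ℂ)) • elemOp l (a, j - k) (b, j) := by
  have h := (locFin_glTerms (l := l) (phi (mono k a b f))).comp (diag_injective k a b)
  convert h using 2 with j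
  simp [glTerms, phi_mono_apply]

/-- The case `f = 1` already gives local finiteness of the bare diagonal, after which the
coefficients are arbitrary. -/
theorem locFin_band (k : ℤ) (a b : Fin 2) (c : ℤ → ℂ) :
    LocFin fun j : ℤ => c j • elemOp l (a, j - k) (b, j) := by
  simpa using (locFin_diag l k a b 1).smul c

theorem actS_mono (k : ℤ) (a b : Fin 2) (f : ℂ[X]) :
    actS l (mono k a b f) =
      locSum fun j : ℤ => f.eval (-(j : ℂ)) • elemOp l (a, j - k) (b, j) := by
  have h := locFin_diag l k a b f
  have e : (fun j : ℤ => f.eval (-(j : ℂ)) • elemOp l (a, j - k) (b, j)) =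
      fun j => glTerms l (phi (mono k a b f)) ((a, j - k), (b, j)) := by
    funext j
    simp [glTerms, phi_mono_apply]
  rw [e] at h ⊢
  refine (locSum_comp h (diag_injective k a b) ?_).2
  rintro ⟨x, y⟩ hxy
  simp only [glTerms, phi_mono_apply]
  rw [if_neg, zero_smul]
  rintro ⟨rfl, hy⟩
  exact hxy ⟨y.2, by simp [← hy]⟩

theorem actS_mul_mono (r s : ℤ) (a b c d : Fin 2) (f g : ℂ[X]) :
    actS l (mul (mono r a b f) (mono s c d g)) = locSum fun j : ℤ =>
      (f.eval (-((j - s : ℤ) : ℂ)) * g.eval (-(j : ℂ)) * if b = c then 1 else 0) •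
        elemOp l (a, j - s - r) (d, j) := by
  rw [mul_mono]
  split_ifs with h
  · rw [actS_mono]
    congr 1
    funext j
    congr 1
    · simp [transl]; ring_nf; simp
    · rw [sub_sub, add_comm s]
  · simp [locSum_zero]

/-- The difference of step functions is the indicator of `0 < i ≤ r` if `r ≥ 0`, and minus the
indicator of `r < i ≤ 0` if `r < 0`. The substitution `j = -i` turns these into the two ranges of
the cocycle, and `isgn a` is the sign of the supertrace. -/
theorem sum_cocycleTerm (r s : ℤ) (a b c d : Fin 2) (f g : ℂ[X]) :
    LocFin (fun ij : ℤ × ℤ => (f.eval (-(ij.1 : ℂ)) * g.eval (-(ij.2 : ℂ)) *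
      if (b, ij.1) = (c, ij.2 - s) ∧ (a, ij.1 - r) = (d, ij.2) then isgn a *
          ((if ij.1 - r ≤ 0 then 1 else 0) - (if ij.1 ≤ 0 then 1 else 0)) * l else 0) •
        (1 : Module.End ℂ (Fock l))) ∧
    locSum (fun ij : ℤ × ℤ => (f.eval (-(ij.1 : ℂ)) * g.eval (-(ij.2 : ℂ)) *
      if (b, ij.1) = (c, ij.2 - s) ∧ (a, ij.1 - r) = (d, ij.2) then isgn a *
          ((if ij.1 - r ≤ 0 then 1 else 0) - (if ij.1 ≤ 0 then 1 else 0)) * l else 0) •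
        (1 : Module.End ℂ (Fock l))) =
      (cocycleTerm r s (Matrix.single a b f) (Matrix.single c d g) * l) • 1 := by
  set F : ℤ → ℂ := fun i => f.eval (-(i : ℂ)) * g.eval (-((i - r : ℤ) : ℂ)) *
      if r + s = 0 ∧ b = c ∧ a = d then isgn a *
          ((if i ≤ r then 1 else 0) - (if i ≤ 0 then 1 else 0)) * l else 0 with hF
  have hinj : Function.Injective fun i : ℤ => (i, i - r) := fun i j h => by simp at h; exact h
  have h0 : ∀ i ∉ Finset.Ioc (min 0 r) (max 0 r), F i • (1 : Module.End ℂ (Fock l)) = 0 := by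
    intro i hi
    rw [Finset.mem_Ioc] at hi
    have : ((if i ≤ r then 1 else 0) - (if i ≤ 0 then 1 else 0) : ℂ) = 0 := by
      split_ifs <;> first | ring1 | (exfalso; omega)
    simp [hF, this]
  refine (locSum_comp (e := fun i : ℤ => (i, i - r)) ?_ hinj ?_).imp_right fun h => ?_
  rotate_left 2
  · rw [h]
    have e : ∀ i : ℤ, (f.eval (-(i : ℂ)) * g.eval (-((i - r : ℤ) : ℂ)) *
        if (b, i) = (c, i - r - s) ∧ (a, i - r) = (d, i - r) then isgn a *
          ((if i - r ≤ 0 then 1 else 0) - (if i ≤ 0 then 1 else 0)) * l else 0) = F i := by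
      intro i
      simp only [hF, Prod.mk.injEq, sub_nonpos, and_true]
      congr 1
      refine if_congr ?_ rfl rfl
      constructor
      · rintro ⟨⟨h1, h2⟩, h3⟩; exact ⟨by omega, h1, h3⟩
      · rintro ⟨h1, h2, h3⟩; exact ⟨⟨h2, by omega⟩, h3⟩
    simp only [e]
    rw [locSum_finite _ h0, ← Finset.sum_smul]
    congr 1
    unfold cocycleTerm
    simp only [strEval_single]
    by_cases hrs : r + s = 0
    swap
    · simp [hF, hrs]
    by_cases hbc : b = c ∧ a = d
    swap
    · simp [hF, hbc]
    simp only [hF, hrs, hbc, and_self, if_true]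
    split_ifs with hr
    · rw [min_eq_left hr, max_eq_right hr, Finset.sum_mul]
      refine Finset.sum_nbij' (fun i => -i) (fun i => -i) ?_ ?_ ?_ ?_ ?_
      · intro i hi; rw [Finset.mem_Ioc] at hi; rw [Finset.mem_Ico]; omega
      · intro i hi; rw [Finset.mem_Ico] at hi; rw [Finset.mem_Ioc]; omega
      · simp
      · simp
      · intro i hi
        rw [Finset.mem_Ioc] at hi
        rw [if_pos hi.2, if_neg (by omega)]
        push_cast
        rw [show -((i : ℂ) - r) = -i + r by ring]
        ring
    · rw [not_le] at hr
      rw [min_eq_right hr.le, max_eq_left hr.le, neg_mul, Finset.sum_mul, ← Finset.sum_neg_distrib]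
      refine Finset.sum_nbij' (fun i => -i) (fun i => -i) ?_ ?_ ?_ ?_ ?_
      · intro i hi; rw [Finset.mem_Ioc] at hi; rw [Finset.mem_Ico]; omega
      · intro i hi; rw [Finset.mem_Ico] at hi; rw [Finset.mem_Ioc]; omega
      · simp
      · simp
      · intro i hi
        rw [Finset.mem_Ioc] at hi
        rw [if_neg (by omega), if_pos hi.2]
        push_cast
        rw [show -((i : ℂ) - r) = -i + r by ring]
        ring
  · refine LocFin.of_finite (Finset.Ioc (min 0 r) (max 0 r)) fun i hi => ?_
    rw [Finset.mem_Ioc] at hi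
    have : ((if i - r ≤ 0 then 1 else 0) - (if i ≤ 0 then 1 else 0) : ℂ) = 0 := by
      split_ifs <;> first | ring1 | (exfalso; omega)
    simp only [this, mul_zero, zero_mul, ite_self, zero_smul]
  · rintro ⟨i, j⟩ hij
    rw [if_neg, mul_zero, zero_smul]
    rintro ⟨-, h⟩
    simp only [Prod.mk.injEq] at h
    exact hij ⟨i, by simp [h.2]⟩

/-- Both products become sums over the same pairs `(i, j)`, to which `elemOp_bracket` applies
termwise. Its two delta terms restrict to the lines `i = j - s` and `j = i - r` and give the
products of operators in the two orders; its scalar term gives the cocycle. -/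
theorem actS_bracket_mono (r s : ℤ) (a b c d : Fin 2) (f g : ℂ[X]) :
    actS l (sbr (mono r a b f) (mono s c d g))
        + (cocycle (mono r a b f) (mono s c d g) * l) • 1 =
      actS l (mono r a b f) * actS l (mono s c d g)
        - koszul (a + b) (c + d) • (actS l (mono s c d g) * actS l (mono r a b f)) := by
  set κ := koszul (a + b) (c + d) with hκ
  have hf := locFin_diag l r a b f
  have hg := locFin_diag l s c d g
  rw [sbr_mono, map_sub, map_smul, actS_mul_mono, actS_mul_mono, cocycle_mono,
    ← (sum_cocycleTerm l r s a b c d f g).2,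
    actS_mono, actS_mono, locSum_mul hf hg, locSum_mul hg hf,
    locSum_equiv (Equiv.prodComm ℤ ℤ) (f := fun x : ℤ × ℤ =>
      g.eval (-(x.1 : ℂ)) • elemOp l (c, x.1 - s) (d, x.1) *
        f.eval (-(x.2 : ℂ)) • elemOp l (a, x.2 - r) (b, x.2))]
  have hfg := hf.mul hg
  have hgf := (hg.mul hf).comp (Equiv.prodComm ℤ ℤ).injective
  have hneg := hgf.smul fun _ => -κ
  rw [sub_eq_add_neg, sub_eq_add_neg, ← neg_smul, ← neg_smul, ← locSum_const_smul hgf,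
    ← locSum_add hfg hneg]
  have hE : ∀ ij : ℤ × ℤ,
      f.eval (-(ij.1 : ℂ)) • elemOp l (a, ij.1 - r) (b, ij.1) *
          g.eval (-(ij.2 : ℂ)) • elemOp l (c, ij.2 - s) (d, ij.2)
        + -κ • (g.eval (-(ij.2 : ℂ)) • elemOp l (c, ij.2 - s) (d, ij.2) *
            f.eval (-(ij.1 : ℂ)) • elemOp l (a, ij.1 - r) (b, ij.1)) =
      ((f.eval (-(ij.1 : ℂ)) * g.eval (-(ij.2 : ℂ)) *
          if (b, ij.1) = (c, ij.2 - s) then 1 else 0) • elemOp l (a, ij.1 - r) (d, ij.2)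
        + -κ • ((g.eval (-(ij.2 : ℂ)) * f.eval (-(ij.1 : ℂ)) *
          if (a, ij.1 - r) = (d, ij.2) then 1 else 0) • elemOp l (c, ij.2 - s) (b, ij.1)))
        + (f.eval (-(ij.1 : ℂ)) * g.eval (-(ij.2 : ℂ)) *
          if (b, ij.1) = (c, ij.2 - s) ∧ (a, ij.1 - r) = (d, ij.2) then isgn a *
          ((if ij.1 - r ≤ 0 then 1 else 0) - (if ij.1 ≤ 0 then 1 else 0)) * l else 0) •
          1 := by
    rintro ⟨i, j⟩
    have h := elemOp_bracket (l := l) (a, i - r) (b, i) (c, j - s) (d, j)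
    simp only [← hκ] at h
    rw [sub_eq_iff_eq_add] at h
    rw [smul_mul_smul_comm, smul_mul_smul_comm, h]
    have e : (if (a, i - r) = (d, j) then κ else 0) =
        κ * if (a, i - r) = (d, j) then 1 else 0 := by
      split_ifs <;> simp
    rw [e]
    module
  -- The sum may be split only after each of the three families is known to be locally finite on its
  -- own.
  have h1 := locFin_band l (s + r) a d fun j =>
    f.eval (-((j - s : ℤ) : ℂ)) * g.eval (-(j : ℂ)) * if b = c then 1 else 0
  have h2 := locFin_band l (r + s) c b fun j =>
    g.eval (-((j - r : ℤ) : ℂ)) * f.eval (-(j : ℂ)) * if d = a then 1 else 0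
  simp only [← sub_sub] at h1 h2
  have t1 := locSum_comp (f := fun ij : ℤ × ℤ => (f.eval (-(ij.1 : ℂ)) * g.eval (-(ij.2 : ℂ)) *
      if (b, ij.1) = (c, ij.2 - s) then 1 else 0) • elemOp l (a, ij.1 - r) (d, ij.2))
    (e := fun j : ℤ => (j - s, j)) (by simpa using h1) (fun i j h => by simpa using h)
    (by
      rintro ⟨i, j⟩ hij
      rw [if_neg, mul_zero, zero_smul]
      intro h
      simp only [Prod.mk.injEq] at h
      exact hij ⟨j, by simp [h.2]⟩)
  have t2 := locSum_comp (f := fun ij : ℤ × ℤ => (g.eval (-(ij.2 : ℂ)) * f.eval (-(ij.1 : ℂ)) *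
      if (a, ij.1 - r) = (d, ij.2) then 1 else 0) • elemOp l (c, ij.2 - s) (b, ij.1))
    (e := fun j : ℤ => (j, j - r)) (by simpa [eq_comm (a := a)] using h2)
    (fun i j h => by simpa using h)
    (by
      rintro ⟨i, j⟩ hij
      rw [if_neg, mul_zero, zero_smul]
      intro h
      simp only [Prod.mk.injEq] at h
      exact hij ⟨i, by simp [h.2]⟩)
  have t3 := sum_cocycleTerm l r s a b c d f g
  refine Eq.trans ?_ (congrArg locSum (funext fun ij => (hE ij).symm))
  rw [locSum_add (t1.1.add (t2.1.smul fun _ => -κ)) t3.1, locSum_add t1.1 (t2.1.smul fun _ => -κ),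
    locSum_const_smul t2.1, t1.2, t2.2]
  simp [eq_comm (a := a), hκ]

theorem actS_bracket (A B : SD) :
    actS l (sbr A B) + (cocycle A B * l) • 1 = ∑ p, ∑ q,
      (actS l (part p A) * actS l (part q B)
        - koszul p q • (actS l (part q B) * actS l (part p A))) := by
  induction A using SD.induction with
  | zero => simp [sbr_zero_left, cocycle_zero_left, part_zero]
  | add A A' hA hA' =>
    rw [sbr_add_left, cocycle_add_left, map_add, add_mul, add_smul, add_add_add_comm, hA, hA']
    simp only [part_add, map_add, mul_add, add_mul, ← Finset.sum_add_distrib]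
    refine Finset.sum_congr rfl fun p _ => Finset.sum_congr rfl fun q _ => ?_
    module
  | mono r a b f =>
    induction B using SD.induction with
    | zero => simp [sbr_zero_right, cocycle_zero_right, part_zero]
    | add B B' hB hB' =>
      rw [sbr_add_right, cocycle_add_right, map_add, add_mul, add_smul, add_add_add_comm, hB, hB']
      simp only [part_add, map_add, mul_add, add_mul, ← Finset.sum_add_distrib]
      refine Finset.sum_congr rfl fun p _ => Finset.sum_congr rfl fun q _ => ?_
      module
    | mono s c d g =>
      rw [actS_bracket_mono]
      exact (sum_part_mono r s a b c d f g (fun p q A B => actS l A * actS l B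
        - koszul p q • (actS l B * actS l A)) (by simp) (by simp)).symm

theorem parityOp_elemOp (x y : Fin 2 × ℤ) :
    parityOp l * elemOp l x y =
      (-1 : ℂ) ^ (x.1 + y.1).val • (elemOp l x y * parityOp l) := by
  have e : ((-1 : ℂ) ^ (ipar x.1).val * (-1) ^ (ipar y.1).val) = (-1) ^ (x.1 + y.1).val := by
    generalize x.1 = a
    generalize y.1 = b
    fin_cases a <;> fin_cases b <;> simp [ipar]
  rw [elemOp, mul_smul_comm, smul_mul_assoc, Finset.mul_sum, Finset.sum_mul, smul_comm,
    Finset.smul_sum (r := (-1 : ℂ) ^ _)]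
  simp only [parityOp_nord, rowMode_parity, colMode_parity, e]

theorem parityOp_actS (p : Fin 2) (A : SD) :
    parityOp l * actS l (part p A) = (-1 : ℂ) ^ p.val • (actS l (part p A) * parityOp l) := by
  induction A using SD.induction with
  | zero => simp [part_zero]
  | add A B hA hB => rw [part_add, map_add, mul_add, hA, hB, add_mul, smul_add]
  | mono k a b f =>
    rw [part_mono]
    split_ifs with h
    · have hf := locFin_diag l k a b f
      rw [actS_mono, locSum_mul_left hf, locSum_mul_right hf,
        ← locSum_const_smul (hf.mul_right _)]
      congr 1
      funext j
      rw [mul_smul_comm, parityOp_elemOp, smul_mul_assoc, smul_comm, ← h]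
    · simp

theorem part_of_homog {p : Fin 2} {A : SD} (h : part p A = A) (q : Fin 2) :
    part q A = if q = p then A else 0 := by
  have := part_part q p A
  rwa [h] at this

theorem isSuperRep_act : IsSuperRep l (act l) where
  linear :=
    { map_add := fun x y => by
        simp only [act_eq, Prod.fst_add, Prod.snd_add, map_add]; module
      map_smul := fun c x => by
        simp only [act_eq, Prod.smul_fst, Prod.smul_snd, map_smul, smul_eq_mul]; module }
  parity := fun p x hx => by
    have h := parityOp_actS l p x.1
    rw [hx.1] at h
    rw [act_eq, mul_add, add_mul, h, smul_add, mul_smul_comm, smul_mul_assoc, one_mul, mul_one]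
    congr 1
    by_cases hp : p = 1
    · simp [hx.2 hp]
    · have : p = 0 := by omega
      simp [this]
  bracket := fun p q x y hx hy => by
    have h := actS_bracket l x.1 y.1
    rw [Finset.sum_eq_single p, Finset.sum_eq_single q] at h
    · rw [hx.1, hy.1] at h
      rw [act_eq, act_eq, act_eq, hatBr]
      rw [h]
      -- Scalars drop out of a super-commutator unless the Koszul sign is `-1`; then both elements
      -- are odd and have no central part.
      have hk : koszul p q = 1 ∨ x.2 = 0 ∧ y.2 = 0 := by
        by_cases hp : p = 1
        · by_cases hq : q = 1
          · exact Or.inr ⟨hx.2 hp, hy.2 hq⟩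
          · left
            have : q = 0 := by omega
            simp [this, koszul]
        · left
          have : p = 0 := by omega
          simp [this, koszul]
      simp only [mul_add, add_mul, mul_smul_comm, smul_mul_assoc, mul_one, one_mul]
      rcases hk with hk | ⟨h1, h2⟩
      · rw [hk]; module
      · rw [h1, h2]; module
    · intro q' _ hq'
      simp [part_of_homog hy.1, hq']
    · simp
    · intro p' _ hp'
      simp [part_of_homog hx.1, hp']
    · simp

theorem act_central : act l central = (l : ℂ) • 1 := by
  rw [act_eq]; simp [central]

end Action

/-! ### Normally ordered products of the generating fields -/

section Fields

variable {l : ℕ}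

/-- The field whose modes are the row modes: `ψ⁺` or `γ⁺`. -/
def rowF (a : Fin 2) (p : Fin l) : FField l := fun m => Finsupp.single (rowMode p (a, m + 1)) 1

/-- The field whose modes are the column modes: `ψ⁻` or `γ⁻`. -/
def colF (b : Fin 2) (p : Fin l) : FField l := fun m => Finsupp.single (colMode p (b, -m)) 1

theorem psiP_eq (p : Fin l) : psiP p = rowF 0 p := by
  funext m; simp [psiP, rowF, rowMode, sub_eq_add_neg, add_comm]

theorem gamP_eq (p : Fin l) : gamP p = rowF 1 p := by
  funext m; simp [gamP, rowF, rowMode, sub_eq_add_neg, add_comm]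

theorem psiM_eq (p : Fin l) : psiM p = colF 0 p := by
  funext m; simp [psiM, colF, colMode]

theorem gamM_eq (p : Fin l) : gamM p = colF 1 p := by
  funext m; simp [gamM, colF, colMode]

/-- This is where the falling factorials enter: `∂^n z^(m+n) = [m+n]_n z^m`. -/
theorem dz_iterate (a : FField l) (n : ℕ) (m : ℤ) :
    dz^[n] a m = (fallP n).eval (((m + n : ℤ)) : ℂ) • a (m + n) := by
  induction n generalizing m with
  | zero => simp [fallP]
  | succ n ih =>
    rw [Function.iterate_succ_apply', dz, ih, smul_smul, fallP, fallP, descPochhammer_succ_eval,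
      show m + 1 + (n : ℤ) = m + ((n + 1 : ℕ) : ℤ) by push_cast; ring]
    congr 1
    push_cast
    ring

theorem nordLin_smul_single (c d : ℂ) (u v : Mode l) :
    nordLin (c • Finsupp.single u 1) (d • Finsupp.single v 1) = (c * d) • nord u v := by
  simp [nordLin]

theorem sg_neg_one_zpow_mul (i j : ℤ) :
    sg ((-1) ^ i) * sg ((-1) ^ j) = sg ((-1) ^ (i + j)) := by
  rw [zpow_add, sg_mul]

theorem sg_neg_one_zpow_neg (i : ℤ) : sg ((-1) ^ (-i)) = sg ((-1) ^ i) := by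
  rw [zpow_neg, Int.units_inv_eq_self]

theorem sg_neg_one_zpow_succ (i : ℤ) : sg ((-1) ^ (i + 1)) = -sg ((-1) ^ i) := by
  rw [zpow_add, sg_mul]; simp [sg]

theorem locFin_nord_band (p : Fin l) (k : ℤ) (a b : Fin 2) (c : ℤ → ℂ) :
    LocFin fun j : ℤ => c j • nord (rowMode p (a, j - k)) (colMode p (b, j)) := by
  have h := ((locFin_matrix (phi (mono k a b 1)) p).comp (diag_injective k a b)).smul c
  simpa [phi_mono_apply] using h

/-- A sum of normally ordered products, all of whose terms belong to one diagonal. -/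
theorem sum_nprod {A B : Fin l → FField l} {m k : ℤ} (a b : Fin 2) (f : ℂ[X]) (e : ℤ ≃ ℤ)
    (h : ∀ p i, nordTerms (A p) (B p) m i =
      f.eval (-((e i : ℤ) : ℂ)) • nord (rowMode p (a, e i - k)) (colMode p (b, e i))) :
    ∑ p, nprod (A p) (B p) m = isgn a • actS l (mono k a b f) := by
  have hp : ∀ p, nprod (A p) (B p) m = locSum fun j : ℤ =>
      f.eval (-(j : ℂ)) • nord (rowMode p (a, j - k)) (colMode p (b, j)) := fun p => by
    rw [locSum_equiv e, nprod, funext (h p)]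
  rw [Finset.sum_congr rfl fun p _ => hp p, ← locSum_sum _ fun p => locFin_nord_band p k a b _,
    actS_mono, ← locSum_const_smul (locFin_diag l k a b f)]
  congr 1
  funext j
  have he : elemOp l (a, j - k) (b, j) =
      isgn a • ∑ p : Fin l, nord (rowMode p (a, j - k)) (colMode p (b, j)) := rfl
  rw [he, smul_comm (isgn a), smul_smul (isgn a), isgn_mul_self, one_smul, Finset.smul_sum]

theorem eval_refl (c : ℤ) (f : ℂ[X]) (x : ℂ) : (refl c f).eval x = f.eval (-x - c) := by
  simp [refl]

theorem nord_row_col_congr {p : Fin l} {a b : Fin 2} {i i' j j' : ℤ} (hi : i = i') (hj : j = j') :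
    nord (rowMode p (a, i)) (colMode p (b, j)) = nord (rowMode p (a, i')) (colMode p (b, j')) := by
  rw [hi, hj]

variable (m : ℤ) (n : ℕ) (a b : Fin 2)

/-- The `i`-th term has row index `i + 1` and column index `j = i - m - n`, hence lies on the
diagonal `k = -m - n - 1`; its weight `[m - i + n]_n` is `[D]_n` at `D = -j`. -/
theorem sum_nprod_row_dz_col :
    ∑ p : Fin l, nprod (rowF a p) (dz^[n] (colF b p)) m =
      isgn a • actS l (mono (-m - n - 1) a b (fallP n)) := by
  refine sum_nprod a b _ (Equiv.subRight (m + n)) fun p i => ?_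
  rw [nordTerms, dz_iterate, rowF, colF, ← one_smul ℂ (Finsupp.single (rowMode _ _) _),
    nordLin_smul_single, one_mul, Equiv.subRight_apply]
  congr 2
  · push_cast; ring
  · congr 2; ring
  · congr 2; ring

/-- Now the weight is `[i + n]_n` with `j = i - m`, and `i + n = j - k - 1` is `-D - k - 1` at `D =
-j`. The index `k + 1` of `refl` is left unsimplified to match the spanning elements. -/
theorem sum_nprod_dz_row_col :
    ∑ p : Fin l, nprod (dz^[n] (rowF a p)) (colF b p) m =
      isgn a • actS l (mono (-m - n - 1) a b (refl (-m - n - 1 + 1) (fallP n))) := by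
  refine sum_nprod a b _ (Equiv.subRight m) fun p i => ?_
  rw [nordTerms, dz_iterate, rowF, colF, ← one_smul ℂ (Finsupp.single (colMode _ _) _),
    nordLin_smul_single, mul_one, Equiv.subRight_apply, eval_refl]
  congr 2
  · push_cast; ring
  · congr 2; ring
  · congr 2; ring

/-- The two signs multiply to `(-1)^(m+n)`, which does not depend on the summation index. -/
theorem sum_nprod_dz_zneg_row_zneg_col :
    ∑ p : Fin l, nprod (dz^[n] (zneg (rowF a p))) (zneg (colF b p)) m =
      isgn a • sg ((-1) ^ (-m - n - 1 + 1)) •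
        actS l (mono (-m - n - 1) a b (refl (-m - n - 1 + 1) (fallP n))) := by
  rw [← map_smul, ← mono_smul]
  refine sum_nprod a b _ (Equiv.subRight m) fun p i => ?_
  rw [nordTerms, dz_iterate, zneg, zneg, rowF, colF, smul_smul,
    nordLin_smul_single, Equiv.subRight_apply, Polynomial.eval_smul, eval_refl, smul_eq_mul,
    mul_assoc, sg_neg_one_zpow_mul, mul_comm, ← sg_neg_one_zpow_neg]
  congr 1
  · rw [show -(i + (n : ℤ) + (m - i)) = -m - n - 1 + 1 by ring]
    congr 2
    push_cast
    ring
  · exact nord_row_col_congr (by ring) (by ring)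

/-- Multiplication by `z` before differentiating lowers the row index by one and keeps the weight:
the diagonal becomes `k + 1` and the reflected polynomial is unchanged. The sign changes by a factor
`-1`. -/
theorem sum_nprod_dz_zmul_zneg_row_zneg_col :
    ∑ p : Fin l, nprod (dz^[n] (zmul (zneg (rowF a p)))) (zneg (colF b p)) m =
      isgn a • sg ((-1) ^ (-m - n - 1)) •
        actS l (mono (-m - n - 1 + 1) a b (refl (-m - n - 1 + 1) (fallP n))) := by
  rw [← map_smul, ← mono_smul]
  refine sum_nprod a b _ (Equiv.subRight m) fun p i => ?_
  rw [nordTerms, dz_iterate, zmul, zneg, zneg, rowF, colF, smul_smul,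
    nordLin_smul_single, Equiv.subRight_apply, Polynomial.eval_smul, eval_refl, smul_eq_mul,
    mul_assoc, sg_neg_one_zpow_mul, mul_comm, show i + (n : ℤ) - 1 + (m - i) = m + n + 1 - 2 by ring,
    zpow_sub, ← sg_neg_one_zpow_neg (-m - n - 1)]
  congr 1
  · rw [show -(-m - (n : ℤ) - 1) = m + n + 1 by ring]
    congr 2
    · simp
    · push_cast
      ring
  · exact nord_row_col_congr (by ring) (by ring)

/-- A column field in front of a bosonic row field. -/
theorem sum_nprod_dz_col_row :
    ∑ p : Fin l, nprod (dz^[n] (colF b p)) (rowF 1 p) m =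
      -actS l (mono (-m - n - 1) 1 b (fallP n)) := by
  have h : ∑ p : Fin l, nprod (dz^[n] (colF b p)) (rowF 1 p) m =
      isgn 1 • actS l (mono (-m - n - 1) 1 b (fallP n)) := by
    refine sum_nprod 1 b _ (Equiv.subLeft (-n : ℤ)) fun p i => ?_
    rw [nordTerms, dz_iterate, rowF, colF, ← one_smul ℂ (Finsupp.single (rowMode _ _) _),
      nordLin_smul_single, mul_one, nord_comm, colMode_parity, rowMode_parity, Equiv.subLeft_apply]
    -- The row field is bosonic, so exchanging the factors under normal ordering costs no sign.
    have hk : koszul (ipar b) (ipar 1) = 1 := by simp [ipar, koszul]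
    rw [hk, one_smul]
    congr 2
    · push_cast; ring
    · congr 2; ring
    · congr 2; ring
  rw [h]
  simp [isgn]

theorem isgn_zero : isgn 0 = 1 := rfl

theorem isgn_one : isgn 1 = -1 := rfl

/-! ### The generating functions -/

theorem gen_apply (W : ℤ → SD) : gen l n W m = actS l (W (-m - n - 1)) := act_toHat _ _

theorem gen_J :
    gen l n (J 0 0 n) = -∑ p, nprod (psiP p) (dz^[n] (psiM p)) ∧
    gen l n (J 1 1 n) = ∑ p, nprod (gamP p) (dz^[n] (gamM p)) ∧
    gen l n (J 0 1 n) = -∑ p, nprod (psiP p) (dz^[n] (gamM p)) ∧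
    gen l n (J 1 0 n) = ∑ p, nprod (gamP p) (dz^[n] (psiM p)) := by
  simp only [psiP_eq, gamP_eq, psiM_eq, gamM_eq]
  refine ⟨?_, ?_, ?_, ?_⟩ <;> funext m <;>
    simp [gen_apply, J, Finset.sum_apply, sum_nprod_row_dz_col, isgn]

theorem gen_wZero :
    gen l n (wZero0 n) = ∑ p, (nprod (psiP p) (dz^[n] (psiM p))
      + zinv (nprod (dz^[n] (zmul (zneg (psiP p)))) (zneg (psiM p)))) ∧
    gen l n (wZero1 n) = -∑ p, (nprod (dz^[n] (gamM p)) (gamP p)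
      + nprod (dz^[n] (zneg (gamP p))) (zneg (gamM p))) ∧
    gen l n (wZeroX n) = -∑ p, (nprod (dz^[n] (psiM p)) (gamP p)
      + nprod (dz^[n] (zmul (zneg (psiP p)))) (zneg (gamM p))) := by
  simp only [psiP_eq, gamP_eq, psiM_eq, gamM_eq]
  refine ⟨?_, ?_, ?_⟩ <;> funext m
  -- The factor `z⁻¹` reads the coefficient at `m + 1`, which returns the diagonal to `k` and makes
  -- the reflection `-D - k` instead of `-D - k - 1`.
  · have h := sum_nprod_dz_zmul_zneg_row_zneg_col (l := l) (m + 1) n 0 0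
    rw [show -(m + 1) - (n : ℤ) - 1 + 1 = -m - n - 1 by ring] at h
    simp only [gen_apply, Finset.sum_apply, Pi.add_apply, Finset.sum_add_distrib, zinv,
      sum_nprod_row_dz_col, h, wZero0, mono_add, mono_smul, map_add, map_smul]
    rw [show -m - (n : ℤ) - 1 + 1 = (-(m + 1) - n - 1) + 1 + 1 by ring, sg_neg_one_zpow_succ,
      sg_neg_one_zpow_succ]
    simp [isgn]
  · simp only [gen_apply, Finset.sum_apply, Pi.add_apply, Pi.neg_apply, Finset.sum_add_distrib,
      sum_nprod_dz_col_row, sum_nprod_dz_zneg_row_zneg_col, wZero1, mono_add, mono_smul, map_add,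
      map_smul]
    simp [isgn]
    abel
  · simp only [gen_apply, Finset.sum_apply, Pi.add_apply, Pi.neg_apply, Finset.sum_add_distrib,
      sum_nprod_dz_col_row, sum_nprod_dz_zmul_zneg_row_zneg_col, wZeroX, map_add,
      map_smul, sg_neg_one_zpow_succ]
    simp [isgn]
    abel

theorem gen_wSign_one (η : ℤˣ) :
    gen l n (wSign 1 n) = ∑ p, (nprod (psiP p) (dz^[n] (psiM p))
      + nprod (dz^[n] (gamP p)) (gamM p)) ∧
    gen l n (wSignPlus 1 η n) = -∑ p, (nprod (gamP p) (dz^[n] (psiM p))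
      - sg η • nprod (dz^[n] (gamP p)) (psiM p)) ∧
    gen l n (wSignMinus 1 η n) = ∑ p, (nprod (psiP p) (dz^[n] (gamM p))
      + sg η • nprod (dz^[n] (psiP p)) (gamM p)) := by
  have h1 : sg 1 = 1 := by simp [sg]
  simp only [psiP_eq, gamP_eq, psiM_eq, gamM_eq]
  refine ⟨?_, ?_, ?_⟩ <;> funext m <;>
    simp only [gen_apply, Finset.sum_apply, Pi.add_apply, Pi.neg_apply, Pi.smul_apply,
      Finset.sum_add_distrib, Finset.sum_neg_distrib, ← Finset.smul_sum, sum_nprod_row_dz_col,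
      sum_nprod_dz_row_col, wSign, wSignPlus, wSignMinus, one_zpow, h1, mul_one, sub_eq_add_neg,
      mono_add, mono_neg, mono_smul, map_add, map_neg, map_smul] <;>
    simp only [isgn_zero, isgn_one] <;> module

theorem gen_wSign_neg_one (η : ℤˣ) :
    gen l n (wSign (-1) n) = ∑ p, (nprod (psiP p) (dz^[n] (psiM p))
      - nprod (dz^[n] (zneg (gamP p))) (zneg (gamM p))) ∧
    gen l n (wSignPlus (-1) η n) = -∑ p, (nprod (gamP p) (dz^[n] (psiM p))
      + sg η • nprod (dz^[n] (zneg (gamP p))) (zneg (psiM p))) ∧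
    gen l n (wSignMinus (-1) η n) = ∑ p, (nprod (psiP p) (dz^[n] (gamM p))
      - sg η • nprod (dz^[n] (zneg (psiP p))) (zneg (gamM p))) := by
  simp only [psiP_eq, gamP_eq, psiM_eq, gamM_eq]
  refine ⟨?_, ?_, ?_⟩ <;> funext m <;>
    simp only [gen_apply, Finset.sum_apply, Pi.add_apply, Pi.neg_apply, Pi.smul_apply,
      Finset.sum_add_distrib, Finset.sum_neg_distrib, ← Finset.smul_sum, sum_nprod_row_dz_col,
      sum_nprod_dz_zneg_row_zneg_col, wSign, wSignPlus, wSignMinus, sg_neg_one_zpow_succ,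
      sub_eq_add_neg, mono_add, mono_neg, mono_smul, map_add, map_neg, map_smul] <;>
    simp only [isgn_zero, isgn_one] <;> module

end Fields

/-! ### The subalgebras of the anti-involutions -/

theorem part_smul (p : Fin 2) (c : ℂ) (A : SD) : part p (c • A) = c • part p A := by
  induction A using SD.induction with
  | zero => simp [part_zero]
  | add A B hA hB => rw [smul_add, part_add, hA, hB, part_add, smul_add]
  | mono k a b f => rw [← mono_smul, part_mono, part_mono]; split_ifs <;> simp [mono_smul]

theorem part_neg (p : Fin 2) (A : SD) : part p (-A) = -part p A := by
  simpa using part_smul p (-1) A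

theorem sbr_neg_left (A B : SD) : sbr (-A) B = -sbr A B := by
  rw [eq_neg_iff_add_eq_zero, ← sbr_add_left, neg_add_cancel, sbr_zero_left]

theorem sbr_neg_right (A B : SD) : sbr A (-B) = -sbr A B := by
  rw [eq_neg_iff_add_eq_zero, ← sbr_add_right, neg_add_cancel, sbr_zero_right]

theorem sbr_of_homog {p q : Fin 2} {A B : SD} (hA : part p A = A) (hB : part q B = B) :
    sbr A B = mul A B - koszul p q • mul B A := by
  unfold sbr
  rw [Finset.sum_eq_single p, Finset.sum_eq_single q, hA, hB]
  · intro q' _ hq'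
    rw [part_of_homog hB q', if_neg hq', mul_zero_left, mul_zero_right, smul_zero, sub_zero]
  · simp
  · intro p' _ hp'
    refine Finset.sum_eq_zero fun q' _ => ?_
    rw [part_of_homog hA p', if_neg hp', mul_zero_left, mul_zero_right, smul_zero, sub_zero]
  · simp

/-- A parity preserving linear map that reverses products up to the Koszul sign. -/
structure IsAntiMap (σ : SD →ₗ[ℂ] SD) : Prop where
  map_mul : ∀ r s a b c d f g, σ (mul (mono r a b f) (mono s c d g)) =
    koszul (a + b) (c + d) • mul (σ (mono s c d g)) (σ (mono r a b f))
  map_part_mono : ∀ p k a b f, σ (part p (mono k a b f)) = part p (σ (mono k a b f))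

namespace IsAntiMap

variable {σ : SD →ₗ[ℂ] SD}

theorem map_part (h : IsAntiMap σ) (p : Fin 2) (A : SD) : σ (part p A) = part p (σ A) := by
  induction A using SD.induction with
  | zero => simp [part_zero]
  | add A B hA hB => rw [part_add, map_add, hA, hB, map_add, part_add]
  | mono k a b f => exact h.map_part_mono p k a b f

/-- Reversing products up to the Koszul sign interchanges the two terms of the super-bracket,
because that sign squares to `1`. -/
theorem map_sbr (h : IsAntiMap σ) (A B : SD) : σ (sbr A B) = -sbr (σ A) (σ B) := by
  induction A using SD.induction with
  | zero => simp [sbr_zero_left]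
  | add A A' hA hA' => rw [sbr_add_left, map_add, hA, hA', map_add, sbr_add_left, neg_add]
  | mono r a b f =>
    induction B using SD.induction with
    | zero => simp [sbr_zero_right]
    | add B B' hB hB' => rw [sbr_add_right, map_add, hB, hB', map_add, sbr_add_right, neg_add]
    | mono s c d g =>
      -- The images need not be monomials, but they are homogeneous of the same parity, which is all
      -- that the bracket formula needs.
      have hp : ∀ k a b f, part (a + b) (σ (mono k a b f)) = σ (mono k a b f) := fun k a b f => by
        rw [← h.map_part, part_mono, if_pos rfl]
      rw [sbr_of_homog (hp r a b f) (hp s c d g), sbr_mono, map_sub, map_smul, h.map_mul,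
        h.map_mul, smul_smul, koszul_comm (c + d), koszul_mul_self, one_smul, neg_sub]

theorem isSubSuperalgebra (h : IsAntiMap σ) : IsSubSuperalgebra (fixedHat σ) := by
  refine ⟨fun x hx y hy => ?_, fun x hx p => ?_⟩
  · have hx' : σ x.1 = -x.1 := hx
    have hy' : σ y.1 = -y.1 := hy
    change σ (sbr x.1 y.1) = -sbr x.1 y.1
    rw [h.map_sbr, hx', hy', sbr_neg_left, sbr_neg_right, neg_neg]
  · have hx' : σ x.1 = -x.1 := hx
    change σ (part p x.1) = -part p x.1
    rw [h.map_part, hx', part_neg]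

end IsAntiMap

theorem isAntiMap_sigmaZero : IsAntiMap sigmaZero where
  map_mul := sigmaZero_mul
  map_part_mono := fun p k a b f => by
    have h1 := fun k f => (sigmaZero_mono k f).1
    have h2 := fun k f => (sigmaZero_mono k f).2.1
    have h3 := fun k f => (sigmaZero_mono k f).2.2.1
    have h4 := fun k f => (sigmaZero_mono k f).2.2.2
    fin_cases a <;> fin_cases b <;>
      simp [part_mono, part_smul, part_neg, apply_ite sigmaZero, h1, h2, h3, h4]
    split_ifs <;> simp

theorem isAntiMap_sigmaSign (ε η : ℤˣ) : IsAntiMap (sigmaSign ε η) where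
  map_mul := sigmaSign_mul ε η
  map_part_mono := fun p k a b f => by
    have h1 := fun k f => (sigmaSign_mono ε η k f).1
    have h2 := fun k f => (sigmaSign_mono ε η k f).2.1
    have h3 := fun k f => (sigmaSign_mono ε η k f).2.2.1
    have h4 := fun k f => (sigmaSign_mono ε η k f).2.2.2
    fin_cases a <;> fin_cases b <;>
      simp [part_mono, part_smul, part_neg, apply_ite (sigmaSign ε η), h1, h2, h3, h4]
    split_ifs <;> simp

theorem span_fallP : Submodule.span ℂ (Set.range fallP) = ⊤ := by
  -- There is one monic polynomial of each degree.
  let S : Polynomial.Sequence ℂ := ⟨fallP, fun n => by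
    rw [fallP, Polynomial.degree_eq_natDegree (monic_descPochhammer ℂ n).ne_zero,
      descPochhammer_natDegree]⟩
  exact S.span fun n => by
    change IsUnit (fallP n).leadingCoeff
    rw [fallP, (monic_descPochhammer ℂ n).leadingCoeff]
    exact isUnit_one

/-- A property of differential operators that is linear holds for all of them if it holds for the
`t^k [D]_n M_{ab}`. -/
theorem mono_mem_of_fallP {M : Submodule ℂ SD} {k : ℤ} {a b : Fin 2} (T : SD →ₗ[ℂ] SD)
    (h : ∀ n, T (mono k a b (fallP n)) ∈ M) (f : ℂ[X]) : T (mono k a b f) ∈ M := by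
  have hf : f ∈ Submodule.span ℂ (Set.range fallP) := by rw [span_fallP]; trivial
  induction hf using Submodule.span_induction with
  | mem x hx => obtain ⟨n, rfl⟩ := hx; exact h n
  | zero => rw [mono_zero, map_zero]; exact M.zero_mem
  | add x y _ _ hx hy => rw [mono_add, map_add]; exact M.add_mem hx hy
  | smul c x _ hx => rw [mono_smul, map_smul]; exact M.smul_mem c hx

theorem mem_of_mono_mem {M : Submodule ℂ SD} (T : SD →ₗ[ℂ] SD)
    (h : ∀ k a b f, T (mono k a b f) ∈ M) (A : SD) : T A ∈ M := by
  induction A using SD.induction with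
  | zero => rw [map_zero]; exact M.zero_mem
  | add A B hA hB => rw [map_add]; exact M.add_mem hA hB
  | mono k a b f => exact h k a b f

theorem mem_hatSpan {S : Set SD} {x : HatSD} (h : x.1 ∈ Submodule.span ℂ S) : x ∈ hatSpan S := by
  have e : x = LinearMap.inl ℂ SD ℂ x.1 + x.2 • central := by
    ext <;> simp [central]
  rw [e]
  refine Submodule.add_mem _ ?_ (Submodule.smul_mem _ _ (Submodule.subset_span (Or.inl rfl)))
  have h' := Submodule.mem_map_of_mem (f := LinearMap.inl ℂ SD ℂ) h
  rw [Submodule.map_span] at h'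
  exact Submodule.span_mono (Set.subset_insert _ _) h'

theorem hatSpan_J : hatSpan {x | ∃ a b n k, x = J a b n k} = ⊤ := by
  rw [eq_top_iff]
  refine fun x _ => mem_hatSpan (mem_of_mono_mem LinearMap.id (fun k a b f =>
    mono_mem_of_fallP LinearMap.id (fun n => ?_) f) x.1)
  have h : J a b n k ∈ Submodule.span ℂ {x | ∃ a b n k, x = J a b n k} :=
    Submodule.subset_span ⟨a, b, n, k, rfl⟩
  rw [J] at h
  exact neg_mem_iff.1 h

/-- A family of differences `e - σ e` spans the fixed subalgebra as soon as it spans all the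
differences for `e = t^k f(D) M_{ab}`. -/
theorem hatSpan_eq_fixedHat {σ : SD →ₗ[ℂ] SD} {S : Set SD}
    (hinv : ∀ k a b f, σ (σ (mono k a b f)) = mono k a b f)
    (hS : ∀ x ∈ S, ∃ k a b f, x = mono k a b f - σ (mono k a b f))
    (h : ∀ k a b f, (LinearMap.id - σ : SD →ₗ[ℂ] SD) (mono k a b f) ∈ Submodule.span ℂ S) :
    hatSpan S = fixedHat σ := by
  refine le_antisymm (Submodule.span_le.2 ?_) fun x hx => mem_hatSpan ?_
  · rintro _ (rfl | ⟨x, hx, rfl⟩)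
    · change σ 0 = -0
      simp
    · obtain ⟨k, a, b, f, rfl⟩ := hS x hx
      change σ (_ - _) = -(_ - _)
      rw [map_sub, hinv, neg_sub]
  · have hx' : σ x.1 = -x.1 := hx
    have h2 := mem_of_mono_mem _ h x.1
    -- On the `-1` eigenspace `1 - σ` is multiplication by `2`, which is invertible.
    rw [LinearMap.sub_apply, LinearMap.id_apply, hx', sub_neg_eq_add, ← two_smul ℂ] at h2
    exact (Submodule.smul_mem_iff _ two_ne_zero).1 h2

/-- If the difference of `σ A` lies in a subspace then so does that of `A`. -/
theorem diff_mem_of_map {σ : SD →ₗ[ℂ] SD} {M : Submodule ℂ SD} {A B : SD} {c : ℂ}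
    (hA : σ (σ A) = A) (hB : σ A = c • B) (h : (LinearMap.id - σ : SD →ₗ[ℂ] SD) B ∈ M) :
    (LinearMap.id - σ : SD →ₗ[ℂ] SD) A ∈ M := by
  have e : (LinearMap.id - σ : SD →ₗ[ℂ] SD) A = -(c • (LinearMap.id - σ : SD →ₗ[ℂ] SD) B) := by
    rw [← map_smul, ← hB]
    simp [hA]
  rw [e]
  exact M.neg_mem (M.smul_mem c h)

theorem wZero0_eq (n : ℕ) (k : ℤ) :
    wZero0 n k = mono k 0 0 (fallP n) - sigmaZero (mono k 0 0 (fallP n)) := by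
  rw [(sigmaZero_mono k _).1, wZero0, mono_add, mono_smul, sg_neg_one_zpow_succ, neg_smul,
    sub_eq_add_neg]

theorem wZero1_eq (n : ℕ) (k : ℤ) :
    wZero1 n k = mono k 1 1 (fallP n) - sigmaZero (mono k 1 1 (fallP n)) := by
  rw [(sigmaZero_mono k _).2.1, wZero1, mono_add, mono_smul, sg_neg_one_zpow_succ, neg_smul,
    sub_eq_add_neg]

theorem wZeroX_eq (n : ℕ) (k : ℤ) :
    wZeroX n k = mono k 1 0 (fallP n) - sigmaZero (mono k 1 0 (fallP n)) := by
  rw [(sigmaZero_mono k _).2.2.1, wZeroX, sg_neg_one_zpow_succ, neg_smul, sub_eq_add_neg]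

theorem hatSpan_wZero :
    hatSpan {x | ∃ n k, x = wZero0 n k ∨ x = wZero1 n k ∨ x = wZeroX n k} =
      fixedHat sigmaZero := by
  refine hatSpan_eq_fixedHat sigmaZero_sigmaZero ?_ ?_
  · rintro x ⟨n, k, rfl | rfl | rfl⟩
    · exact ⟨_, _, _, _, wZero0_eq n k⟩
    · exact ⟨_, _, _, _, wZero1_eq n k⟩
    · exact ⟨_, _, _, _, wZeroX_eq n k⟩
  · have h00 := fun k => mono_mem_of_fallP (M := Submodule.span ℂ
      {x | ∃ n k, x = wZero0 n k ∨ x = wZero1 n k ∨ x = wZeroX n k}) (LinearMap.id - sigmaZero)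
      fun n => Submodule.subset_span ⟨n, k, Or.inl (wZero0_eq n k).symm⟩
    have h11 := fun k => mono_mem_of_fallP (M := Submodule.span ℂ
      {x | ∃ n k, x = wZero0 n k ∨ x = wZero1 n k ∨ x = wZeroX n k}) (LinearMap.id - sigmaZero)
      fun n => Submodule.subset_span ⟨n, k, Or.inr (Or.inl (wZero1_eq n k).symm)⟩
    have h10 := fun k => mono_mem_of_fallP (M := Submodule.span ℂ
      {x | ∃ n k, x = wZero0 n k ∨ x = wZero1 n k ∨ x = wZeroX n k}) (LinearMap.id - sigmaZero)
      fun n => Submodule.subset_span ⟨n, k, Or.inr (Or.inr (wZeroX_eq n k).symm)⟩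
    -- The unit `M₊` has no family of its own: `σ` carries its `k`-th diagonal to the diagonal `k -
    -- 1` of `M₋`.
    have h01 := fun k f => diff_mem_of_map (sigmaZero_sigmaZero k 0 1 f)
      (sigmaZero_mono k f).2.2.2 (h10 (k - 1) (refl k f))
    intro k a b f
    fin_cases a <;> fin_cases b
    · exact h00 k f
    · exact h01 k f
    · exact h10 k f
    · exact h11 k f

theorem wSign_eq (ε η : ℤˣ) (n : ℕ) (k : ℤ) :
    wSign ε n k = mono k 0 0 (fallP n) - sigmaSign ε η (mono k 0 0 (fallP n)) := by
  rw [(sigmaSign_mono ε η k _).1, wSign]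

theorem wSignPlus_eq (ε η : ℤˣ) (n : ℕ) (k : ℤ) :
    wSignPlus ε η n k = mono k 1 0 (fallP n) - sigmaSign ε η (mono k 1 0 (fallP n)) := by
  rw [(sigmaSign_mono ε η k _).2.2.1, wSignPlus, sub_eq_add_neg, mono_add, mono_neg, mono_smul,
    mul_comm, sub_eq_add_neg]

theorem wSignMinus_eq (ε η : ℤˣ) (n : ℕ) (k : ℤ) :
    wSignMinus ε η n k = mono k 0 1 (fallP n) - sigmaSign ε η (mono k 0 1 (fallP n)) := by
  rw [(sigmaSign_mono ε η k _).2.2.2, wSignMinus, mono_add, mono_smul, mul_comm, neg_smul,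
    sub_neg_eq_add]

theorem hatSpan_wSign (ε η : ℤˣ) :
    hatSpan {x | ∃ n k, x = wSign ε n k ∨ x = wSignPlus ε η n k ∨ x = wSignMinus ε η n k} =
      fixedHat (sigmaSign ε η) := by
  refine hatSpan_eq_fixedHat (sigmaSign_sigmaSign ε η) ?_ ?_
  · rintro x ⟨n, k, rfl | rfl | rfl⟩
    · exact ⟨_, _, _, _, wSign_eq ε η n k⟩
    · exact ⟨_, _, _, _, wSignPlus_eq ε η n k⟩
    · exact ⟨_, _, _, _, wSignMinus_eq ε η n k⟩
  · have h00 := fun k => mono_mem_of_fallP (M := Submodule.span ℂ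
      {x | ∃ n k, x = wSign ε n k ∨ x = wSignPlus ε η n k ∨ x = wSignMinus ε η n k})
      (LinearMap.id - sigmaSign ε η)
      fun n => Submodule.subset_span ⟨n, k, Or.inl (wSign_eq ε η n k).symm⟩
    have h10 := fun k => mono_mem_of_fallP (M := Submodule.span ℂ
      {x | ∃ n k, x = wSign ε n k ∨ x = wSignPlus ε η n k ∨ x = wSignMinus ε η n k})
      (LinearMap.id - sigmaSign ε η)
      fun n => Submodule.subset_span ⟨n, k, Or.inr (Or.inl (wSignPlus_eq ε η n k).symm)⟩
    have h01 := fun k => mono_mem_of_fallP (M := Submodule.span ℂ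
      {x | ∃ n k, x = wSign ε n k ∨ x = wSignPlus ε η n k ∨ x = wSignMinus ε η n k})
      (LinearMap.id - sigmaSign ε η)
      fun n => Submodule.subset_span ⟨n, k, Or.inr (Or.inr (wSignMinus_eq ε η n k).symm)⟩
    -- Here `σ` interchanges `M₀` and `M₁`, so the family for `M₀` also accounts for `M₁`.
    have h11 := fun k f => diff_mem_of_map (sigmaSign_sigmaSign ε η k 1 1 f)
      (sigmaSign_mono ε η k f).2.1 (h00 k (refl (k + 1) f))
    intro k a b f
    fin_cases a <;> fin_cases b
    · exact h00 k f
    · exact h01 k f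
    · exact h10 k f
    · exact h11 k f

end SuperW

end

theorem mainTheorem10 (l : ℕ) :
    -- all infinite sums of operators below are locally finite
    (∀ A : GlInf, LocFin (glTerms l A)) ∧
    (∀ a b : FField l, IsFree a → IsFree b → ∀ m, LocFin (nordTerms a b m)) ∧
    -- a representation of central charge `l`
    IsSuperRep l (act l) ∧
    act l central = (l : ℂ) • 1 ∧
    -- the action of the whole superalgebra
    hatSpan {x | ∃ a b n k, x = J a b n k} = ⊤ ∧
    (∀ n : ℕ,
      gen l n (J 0 0 n) = -∑ p, nprod (psiP p) (dz^[n] (psiM p)) ∧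
      gen l n (J 1 1 n) = ∑ p, nprod (gamP p) (dz^[n] (gamM p)) ∧
      gen l n (J 0 1 n) = -∑ p, nprod (psiP p) (dz^[n] (gamM p)) ∧
      gen l n (J 1 0 n) = ∑ p, nprod (gamP p) (dz^[n] (psiM p))) ∧
    -- the action of the subalgebra of the anti-involution `sigmaZero`
    IsSubSuperalgebra (fixedHat sigmaZero) ∧
    hatSpan {x | ∃ n k, x = wZero0 n k ∨ x = wZero1 n k ∨ x = wZeroX n k} = fixedHat sigmaZero ∧
    (∀ n : ℕ,
      gen l n (wZero0 n) = ∑ p, (nprod (psiP p) (dz^[n] (psiM p))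
        + zinv (nprod (dz^[n] (zmul (zneg (psiP p)))) (zneg (psiM p)))) ∧
      gen l n (wZero1 n) = -∑ p, (nprod (dz^[n] (gamM p)) (gamP p)
        + nprod (dz^[n] (zneg (gamP p))) (zneg (gamM p))) ∧
      gen l n (wZeroX n) = -∑ p, (nprod (dz^[n] (psiM p)) (gamP p)
        + nprod (dz^[n] (zmul (zneg (psiP p)))) (zneg (gamM p)))) ∧
    -- the action of the subalgebras of the anti-involutions `sigmaSign ε η`
    (∀ ε η : ℤˣ,
      IsSubSuperalgebra (fixedHat (sigmaSign ε η)) ∧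
      hatSpan {x | ∃ n k, x = wSign ε n k ∨ x = wSignPlus ε η n k ∨ x = wSignMinus ε η n k}
        = fixedHat (sigmaSign ε η)) ∧
    -- `ε = +`
    (∀ (η : ℤˣ) (n : ℕ),
      gen l n (wSign 1 n) = ∑ p, (nprod (psiP p) (dz^[n] (psiM p))
        + nprod (dz^[n] (gamP p)) (gamM p)) ∧
      gen l n (wSignPlus 1 η n) = -∑ p, (nprod (gamP p) (dz^[n] (psiM p))
        - sg η • nprod (dz^[n] (gamP p)) (psiM p)) ∧
      gen l n (wSignMinus 1 η n) = ∑ p, (nprod (psiP p) (dz^[n] (gamM p))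
        + sg η • nprod (dz^[n] (psiP p)) (gamM p))) ∧
    -- `ε = -`
    (∀ (η : ℤˣ) (n : ℕ),
      gen l n (wSign (-1) n) = ∑ p, (nprod (psiP p) (dz^[n] (psiM p))
        - nprod (dz^[n] (zneg (gamP p))) (zneg (gamM p))) ∧
      gen l n (wSignPlus (-1) η n) = -∑ p, (nprod (gamP p) (dz^[n] (psiM p))
        + sg η • nprod (dz^[n] (zneg (gamP p))) (zneg (psiM p))) ∧
      gen l n (wSignMinus (-1) η n) = ∑ p, (nprod (psiP p) (dz^[n] (gamM p))
        - sg η • nprod (dz^[n] (zneg (psiP p))) (zneg (gamM p)))) := by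
  exact ⟨locFin_glTerms, fun _ _ => locFin_nordTerms, isSuperRep_act l, act_central l, hatSpan_J,
    gen_J, isAntiMap_sigmaZero.isSubSuperalgebra, hatSpan_wZero, gen_wZero,
    fun ε η => ⟨(isAntiMap_sigmaSign ε η).isSubSuperalgebra, hatSpan_wSign ε η⟩,
    fun η n => gen_wSign_one n η, fun η n => gen_wSign_neg_one n η⟩
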